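/- Let $m$ be a natural number and let $L_1,\dots,L_m\subset\mathbb{C}^2$ be $m$ pairwise distinct complex affine lines whose common intersection $\bigcap_i L_i$ is a single point (so $m\ge 2$). Put $U=\mathbb{C}^2\setminus\bigcup_i L_i$, let $x\in U$ and $G=\pi_1(U,x)$. Then 1. $G\cong F_{m-1}\times\mathbb{Z}$, where $F_{m-1}$ is the free group on $m-1$ generators; 2. for every $n\ge 0$ the $n$-th higher-order degree of $U$ is $\delta_n(U)=m(m-2)$. Here the rational derived series of $G$ is given by $G_r^{(0)}=G$ and $G_r^{(n+1)}=\{g\in G_r^{(n)} : g^k\in[G_r^{(n)},G_r^{(n)}]\text{ for some }k\in\mathbb{Z}\setminus\{0\}\}$, and $\Gamma_n=G/G_r^{(n+1)}$. Let $\psi:G\to\mathbb{Z}$ be the total linking number homomorphism (the sum over $i$ of the linking numbers of a loop with $L_i$, i.e. of the winding numbers about $0$ of the images of the loop under an affine equation of $L_i$), and let $\bar\Gamma_n$ be the kernel of the induced homomorphism $\Gamma_n\to\mathbb{Z}$. The ring $\mathbb{Z}\bar\Gamma_n$ is an Ore domain; let $\mathbb{K}_n$ be its skew field of fractions. The group $\Gamma_n$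 acts by conjugation on the $n$-th order Alexander module $G_r^{(n+1)}/[G_r^{(n+1)},G_r^{(n+1)}]$ (the first homology of the regular $\Gamma_n$-cover of $U$), and $$\delta_n(U)=\operatorname{rk}_{\mathbb{K}_n}\left(\frac{G_r^{(n+1)}}{[G_r^{(n+1)},G_r^{(n+1)}]}\otimes_{\mathbb{Z}\bar\Gamma_n}\mathbb{K}_n\right).$$ -/

import Mathlib

/-! ### The rational derived series -/

/-- One step of the rational derived series: for a subgroup `H` of `G`, the subgroup of all `g ∈ H`
some nonzero power of which lies in `[H, H]`. -/
def rationalCommutator {G : Type*} [Group G] (H : Subgroup G) : Subgroup G where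
  carrier := {g | g ∈ H ∧ ∃ k : ℤ, k ≠ 0 ∧ g ^ k ∈ ⁅H, H⁆}
  one_mem' := ⟨H.one_mem, 1, one_ne_zero, by simp⟩
  inv_mem' := by
    rintro g ⟨hg, k, hk, h⟩
    exact ⟨H.inv_mem hg, k, hk, by simpa using Subgroup.inv_mem _ h⟩
  mul_mem' := by
    rintro a b ⟨ha, k, hk, hka⟩ ⟨hb, l, hl, hlb⟩
    refine ⟨H.mul_mem ha hb, k * l, mul_ne_zero hk hl, ?_⟩
    have key : ∀ x : H, (x : G) ∈ ⁅H, H⁆ ↔ Abelianization.of x = 1 := by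
      intro x
      rw [← MonoidHom.mem_ker, Abelianization.ker_of, ← Subgroup.map_subtype_commutator,
        ← Subgroup.mem_map_iff_mem H.subtype_injective]
      rfl
    have h1 := (key (⟨a, ha⟩ ^ k)).1 (by simpa using hka)
    have h2 := (key (⟨b, hb⟩ ^ l)).1 (by simpa using hlb)
    have h3 := (key ((⟨a, ha⟩ * ⟨b, hb⟩) ^ (k * l))).2 (by
      rw [map_zpow, map_mul, mul_zpow, zpow_mul, ← map_zpow, h1, mul_comm k l, zpow_mul,
        ← map_zpow, h2]
      simp)
    simpa using h3

theorem rationalCommutator_le {G : Type*} [Group G] (H : Subgroup G) :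
    rationalCommutator H ≤ H := fun _ h => h.1

theorem commutator_le_rationalCommutator {G : Type*} [Group G] (H : Subgroup G) :
    ⁅H, H⁆ ≤ rationalCommutator H := fun _ h =>
  ⟨Subgroup.commutator_le_self H h, 1, one_ne_zero, by simpa using h⟩

instance rationalCommutator_normal {G : Type*} [Group G] (H : Subgroup G) [hH : H.Normal] :
    (rationalCommutator H).Normal where
  conj_mem := by
    rintro g ⟨hg, k, hk, h⟩ a
    refine ⟨hH.conj_mem g hg a, k, hk, ?_⟩
    rw [conj_zpow]
    exact (inferInstance : (⁅H, H⁆).Normal).conj_mem _ h a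

/-- The rational derived series `G_r^(n)` of a group `G`: `G_r^(0) = G`, and `G_r^(n+1)` consists of
the `g ∈ G_r^(n)` with `g ^ k ∈ [G_r^(n), G_r^(n)]` for some nonzero integer `k`. -/
def rationalDerivedSeries (G : Type*) [Group G] : ℕ → Subgroup G
  | 0 => ⊤
  | n + 1 => rationalCommutator (rationalDerivedSeries G n)

instance rationalDerivedSeries_normal (G : Type*) [Group G] :
    ∀ n : ℕ, (rationalDerivedSeries G n).Normal
  | 0 => inferInstanceAs (⊤ : Subgroup G).Normal
  | n + 1 =>
    haveI := rationalDerivedSeries_normal G n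
    inferInstanceAs (rationalCommutator (rationalDerivedSeries G n)).Normal

theorem rationalDerivedSeries_succ_le_ker {G : Type*} [Group G] (ψ : G →* Multiplicative ℤ) :
    ∀ n : ℕ, rationalDerivedSeries G (n + 1) ≤ ψ.ker
  | 0 => by
    rintro g ⟨-, k, hk, h⟩
    have h1 : ψ (g ^ k) = 1 :=
      MonoidHom.mem_ker.1 (Abelianization.commutator_subset_ker ψ h)
    rw [map_zpow] at h1
    have h2 : k * (ψ g).toAdd = 0 := by simpa using congrArg Multiplicative.toAdd h1
    rw [MonoidHom.mem_ker]
    exact Multiplicative.toAdd.injective (by simpa [hk] using h2)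
  | n + 1 => (rationalCommutator_le _).trans (rationalDerivedSeries_succ_le_ker ψ n)

/-! ### Group rings of the quotients `G / G_r^(m)` are Ore domains

These facts are needed for the construction of the skew field of fractions below. -/

open Pointwise in
/-- Finite subsets of an abelian group have subexponential growth. -/
theorem exists_card_pow_succ_lt {Q : Type*} [CommGroup Q] [DecidableEq Q] (A : Finset Q)
    (m : ℕ) : ∃ k : ℕ, m * (A ^ (k + 1)).card < (m + 1) * (A ^ k).card := by
  by_contra! hcon
  have hm : m ≠ 0 := by
    rintro rfl
    exact absurd (hcon 0) (by simp)
  have lower : ∀ k : ℕ, (m + 1) ^ k ≤ m ^ k * (A ^ k).card := by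
    intro k
    induction k with
    | zero => simp
    | succ k ih =>
      calc (m + 1) ^ (k + 1) = (m + 1) * (m + 1) ^ k := by ring
        _ ≤ (m + 1) * (m ^ k * (A ^ k).card) := by gcongr
        _ = m ^ k * ((m + 1) * (A ^ k).card) := by ring
        _ ≤ m ^ k * (m * (A ^ (k + 1)).card) := by exact Nat.mul_le_mul_left _ (hcon k)
        _ = _ := by ring
  have upper : ∀ k : ℕ, (A ^ k).card ≤ (k + 1) ^ A.card := by
    intro k
    have hsub : A ^ k ⊆ (Finset.univ : Finset (A → Fin (k + 1))).image
        (fun c => ∏ a : A, (a : Q) ^ (c a : ℕ)) := by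
      suffices h : ∀ k : ℕ, ∀ x ∈ A ^ k, ∃ c : A → ℕ, (∀ a, c a ≤ k) ∧
          ∏ a : A, (a : Q) ^ c a = x by
        intro x hx
        obtain ⟨c, hc, rfl⟩ := h k x hx
        exact Finset.mem_image.2 ⟨fun a => ⟨c a, Nat.lt_succ_of_le (hc a)⟩, by simp, rfl⟩
      intro k
      induction k with
      | zero => intro x hx; exact ⟨fun _ => 0, by simp, by simpa using (by simpa using hx : x = 1).symm⟩
      | succ k ih =>
        intro x hx
        rw [pow_succ, Finset.mem_mul] at hx
        obtain ⟨y, hy, z, hz, rfl⟩ := hx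
        obtain ⟨c, hc, rfl⟩ := ih y hy
        refine ⟨fun a => c a + if a = ⟨z, hz⟩ then 1 else 0, fun a => ?_, ?_⟩
        · have := hc a
          dsimp only
          split_ifs <;> omega
        · simp only [pow_add, Finset.prod_mul_distrib]
          congr 1
          simp [pow_ite, Finset.prod_ite_eq']
    calc (A ^ k).card ≤ _ := Finset.card_le_card hsub
      _ ≤ _ := Finset.card_image_le
      _ = _ := by simp
  have h3 : ∀ k : ℕ, (1 + 1 / (m : ℝ)) ^ k ≤ ((k : ℝ) + 1) ^ A.card := by
    intro k
    have h := (lower k).trans (Nat.mul_le_mul_left _ (upper k))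
    have h' : ((m : ℝ) + 1) ^ k ≤ (m : ℝ) ^ k * ((k : ℝ) + 1) ^ A.card := by exact_mod_cast h
    have hm' : (0 : ℝ) < m := by positivity
    have e : (1 + 1 / (m : ℝ)) = (m + 1) / m := by field_simp
    rw [e, div_pow, div_le_iff₀ (by positivity)]
    linarith
  have hr : 1 < 1 + 1 / (m : ℝ) := by
    have : (0 : ℝ) < 1 / m := by positivity
    linarith
  have t := tendsto_pow_const_div_const_pow_of_one_lt A.card hr
  have t' := (Filter.tendsto_add_atTop_iff_nat 1).2 t
  have t'' : Filter.Tendsto (fun k : ℕ => ((k + 1 : ℕ) : ℝ) ^ A.card / (1 + 1 / (m : ℝ)) ^ (k + 1))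
    Filter.atTop (nhds 0) := t'
  obtain ⟨k, hk⟩ := (t''.eventually (gt_mem_nhds (show (0 : ℝ) < 1 / (1 + 1 / (m : ℝ)) by
    positivity))).exists
  have := h3 k
  rw [pow_succ, div_lt_iff₀ (by positivity)] at hk
  have e : 1 / (1 + 1 / (m : ℝ)) * ((1 + 1 / (m : ℝ)) ^ k * (1 + 1 / (m : ℝ))) =
    (1 + 1 / (m : ℝ)) ^ k := by field_simp
  rw [e] at hk
  push_cast at hk
  linarith

/-- Unique products in an extension. -/
theorem uniqueProds_of_ker {H Q : Type*} [Group H] [Group Q] (π : H →* Q) [UniqueProds Q]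
    (hK : UniqueProds π.ker) : UniqueProds H where
  uniqueMul_of_nonempty {A B} A0 B0 := by
    classical
    obtain ⟨_, ha0, _, hb0, hu⟩ := UniqueProds.uniqueMul_of_nonempty (A0.image π) (B0.image π)
    obtain ⟨a, ha, rfl⟩ := Finset.mem_image.1 ha0
    obtain ⟨b, hb, rfl⟩ := Finset.mem_image.1 hb0
    let A' : Finset π.ker := Finset.univ.image fun x : {x // x ∈ A.filter (π · = π a)} =>
      ⟨a⁻¹ * x.1, by
        rw [MonoidHom.mem_ker, map_mul, map_inv, (Finset.mem_filter.1 x.2).2, inv_mul_cancel]⟩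
    let B' : Finset π.ker := Finset.univ.image fun x : {x // x ∈ B.filter (π · = π b)} =>
      ⟨x.1 * b⁻¹, by
        rw [MonoidHom.mem_ker, map_mul, map_inv, (Finset.mem_filter.1 x.2).2, mul_inv_cancel]⟩
    have memA : ∀ x : π.ker, x ∈ A' ↔ a * x ∈ A := by
      intro x
      simp only [A', Finset.mem_image, Finset.mem_univ, true_and, Subtype.exists,
        Finset.mem_filter, Subtype.ext_iff]
      constructor
      · rintro ⟨y, ⟨hy, -⟩, h⟩
        rw [← h]; simpa using hy
      · intro h
        exact ⟨a * x, ⟨h, by rw [map_mul, MonoidHom.mem_ker.1 x.2, mul_one]⟩, by simp⟩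
    have memB : ∀ x : π.ker, x ∈ B' ↔ (x : H) * b ∈ B := by
      intro x
      simp only [B', Finset.mem_image, Finset.mem_univ, true_and, Subtype.exists,
        Finset.mem_filter, Subtype.ext_iff]
      constructor
      · rintro ⟨y, ⟨hy, -⟩, h⟩
        rw [← h]; simpa using hy
      · intro h
        exact ⟨x * b, ⟨h, by rw [map_mul, MonoidHom.mem_ker.1 x.2, one_mul]⟩, by simp⟩
    obtain ⟨x, hx, y, hy, hxy⟩ := hK.uniqueMul_of_nonempty (A := A') (B := B')
      ⟨1, (memA 1).2 (by simpa using ha)⟩ ⟨1, (memB 1).2 (by simpa using hb)⟩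
    have hxk := MonoidHom.mem_ker.1 x.2
    have hyk := MonoidHom.mem_ker.1 y.2
    refine ⟨a * x, (memA x).1 hx, y * b, (memB y).1 hy, ?_⟩
    intro c d hc hd hcd
    have h1 := hu (Finset.mem_image_of_mem π hc) (Finset.mem_image_of_mem π hd) (by
      rw [← map_mul, hcd]; simp [hxk, hyk])
    have hck : a⁻¹ * c ∈ π.ker := by rw [MonoidHom.mem_ker, map_mul, map_inv, h1.1, inv_mul_cancel]
    have hdk : d * b⁻¹ ∈ π.ker := by rw [MonoidHom.mem_ker, map_mul, map_inv, h1.2, mul_inv_cancel]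
    have h2 := hxy (a := ⟨_, hck⟩) (b := ⟨_, hdk⟩) ((memA _).2 (by simpa using hc))
      ((memB _).2 (by simpa using hd)) (Subtype.ext (by
        have : a⁻¹ * (c * d) * b⁻¹ = x * y := by rw [hcd]; group
        simpa [mul_assoc] using this))
    have h3 := congrArg Subtype.val h2.1
    have h4 := congrArg Subtype.val h2.2
    constructor
    · rw [← h3]; simp
    · rw [← h4]; simp

theorem uniqueProds_of_torsionFree {Q : Type*} [CommGroup Q] [IsMulTorsionFree Q] :
    UniqueProds Q where
  uniqueMul_of_nonempty {A B} A0 B0 := by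
    classical
    let S := Subgroup.closure ((A ∪ B : Finset Q) : Set Q)
    have hSA : ∀ x ∈ A, x ∈ S := fun x hx => Subgroup.subset_closure (by simp [hx])
    have hSB : ∀ x ∈ B, x ∈ S := fun x hx => Subgroup.subset_closure (by simp [hx])
    have : Group.FG S := Group.closure_finset_fg (A ∪ B)
    have : Monoid.FG S := Group.fg_iff_monoid_fg.1 inferInstance
    obtain ⟨a, ha, b, hb, h⟩ := UniqueProds.uniqueMul_of_nonempty
      (A := A.subtype (· ∈ S)) (B := B.subtype (· ∈ S))
      (by obtain ⟨x, hx⟩ := A0; exact ⟨⟨x, hSA x hx⟩, by simpa using hx⟩)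
      (by obtain ⟨x, hx⟩ := B0; exact ⟨⟨x, hSB x hx⟩, by simpa using hx⟩)
    refine ⟨a, by simpa using ha, b, by simpa using hb, fun c d hc hd hcd => ?_⟩
    have := h (a := ⟨c, hSA c hc⟩) (b := ⟨d, hSB d hd⟩) (by simpa using hc) (by simpa using hd)
      (Subtype.ext hcd)
    exact ⟨congrArg Subtype.val this.1, congrArg Subtype.val this.2⟩

open MonoidAlgebra Pointwise in
/-- Strong rank condition in an extension. -/
theorem strongRankCondition_of_ker {H Q : Type*} [Group H] [CommGroup Q] (π : H →* Q)
    (hK : StrongRankCondition (MonoidAlgebra ℤ π.ker)) :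
    StrongRankCondition (MonoidAlgebra ℤ H) := by
  classical
  let R := MonoidAlgebra ℤ π.ker
  let S := MonoidAlgebra ℤ H
  let ι : R →+* S := MonoidAlgebra.mapDomainRingHom ℤ π.ker.subtype
  let _ : Module R S := Module.compHom S ι
  have smul_def : ∀ (r : R) (s : S), r • s = ι r * s := fun _ _ => rfl
  have ι_single : ∀ (k : π.ker) (n : ℤ), ι (single k n) = single (k : H) n := fun k n =>
    MonoidAlgebra.mapDomain_single
  -- a section of `π` on its range
  let sec : Q → H := fun q => if h : ∃ x, π x = q then h.choose else 1
  have sec_spec : ∀ x, π (sec (π x)) = π x := fun x => by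
    have h : ∃ y, π y = π x := ⟨x, rfl⟩
    simp only [sec, dif_pos h]
    exact h.choose_spec
  let kp : H → π.ker := fun x => ⟨x * (sec (π x))⁻¹, by
    rw [MonoidHom.mem_ker, map_mul, map_inv, sec_spec, mul_inv_cancel]⟩
  have kp_mul : ∀ (k : π.ker) (x : H), kp (k * x) = k * kp x := fun k x => Subtype.ext (by
    simp [kp, MonoidHom.mem_ker.1 k.2, mul_assoc])
  have kp_sec : ∀ x : H, kp (sec (π x)) = 1 := fun x => Subtype.ext (by
    simp only [kp, sec_spec]; simp)
  -- coordinates with respect to the right transversal `sec`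
  let Φ₀ : S →+ (Q →₀ R) := (Finsupp.liftAddHom fun x : H =>
    (Finsupp.singleAddHom (π x)).comp (MonoidAlgebra.singleAddHom (kp x) : ℤ →+ R)).comp
      (MonoidAlgebra.coeffAddEquiv : S ≃+ (H →₀ ℤ)).toAddMonoidHom
  have Φ₀_single : ∀ (x : H) (n : ℤ), Φ₀ (single x n) = Finsupp.single (π x) (single (kp x) n) :=
    fun x n =>
    (Finsupp.sum_single_index (by simp)).trans rfl
  have Φ₀_smul : ∀ (r : R) (s : S), Φ₀ (ι r * s) = r • Φ₀ s := by
    intro r s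
    induction r using MonoidAlgebra.induction_linear with
    | zero => simp
    | add a b ha hb => rw [map_add, add_mul, map_add, ha, hb, add_smul]
    | single k n =>
      induction s using MonoidAlgebra.induction_linear with
      | zero => simp
      | add a b ha hb => rw [mul_add, map_add, ha, hb, map_add, smul_add]
      | single x l =>
        rw [ι_single, MonoidAlgebra.single_mul_single, Φ₀_single, Φ₀_single, kp_mul, map_mul,
          MonoidHom.mem_ker.1 k.2, one_mul, Finsupp.smul_single, smul_eq_mul,
          MonoidAlgebra.single_mul_single]
  let Φ : S →ₗ[R] (Q →₀ R) := { Φ₀ with map_smul' := fun r s => Φ₀_smul r s }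
  let Ψ : Q → R →ₗ[R] S := fun q =>
    { toFun := fun r => ι r * single (sec q) 1
      map_add' := fun a b => by rw [map_add, add_mul]
      map_smul' := fun a b => by
        rw [smul_eq_mul, map_mul, mul_assoc, RingHom.id_apply, smul_def] }
  have Ψ_def : ∀ q r, Ψ q r = ι r * single (sec q) 1 := fun _ _ => rfl
  have ΦΨ : ∀ (x : H) (r : R), Φ (Ψ (π x) r) = Finsupp.single (π x) r := fun x r => by
    have h1 : Φ₀ (single (sec (π x)) 1) = Finsupp.single (π x) 1 := by
      rw [Φ₀_single, kp_sec, sec_spec]; rfl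
    have h2 : Φ (Ψ (π x) r) = r • Φ₀ (single (sec (π x)) 1) := Φ₀_smul r _
    rw [h2, h1, Finsupp.smul_single, smul_eq_mul, mul_one]
  have Φ_inj : Function.Injective Φ := by
    have hleft : ∀ s : S, (Φ₀ s).sum (fun q r => Ψ q r) = s := by
      intro s
      induction s using MonoidAlgebra.induction_linear with
      | zero => simp
      | add a b ha hb =>
        rw [map_add, Finsupp.sum_add_index' (by simp) (by simp), ha, hb]
      | single x n =>
        rw [Φ₀_single, Finsupp.sum_single_index (by simp), Ψ_def, ι_single,
          MonoidAlgebra.single_mul_single, mul_one]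
        simp [kp]
    intro a b hab
    rw [← hleft a, ← hleft b]
    exact congrArg (fun y : Q →₀ R => y.sum fun q r => Ψ q r) hab
  -- elements supported over a set of cosets
  let T : Set Q → AddSubgroup S := fun F =>
    AddSubgroup.closure {s | ∃ x n, π x ∈ F ∧ s = single x n}
  have T_mul : ∀ (F F' : Set Q) (s t : S), s ∈ T F → t ∈ T F' → s * t ∈ T (F * F') := by
    intro F F' s t hs ht
    induction hs using AddSubgroup.closure_induction with
    | zero => simp [zero_mem]
    | add a b _ _ ha hb => rw [add_mul]; exact add_mem ha hb
    | neg a _ ha => rw [neg_mul]; exact neg_mem ha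
    | mem a ha =>
      obtain ⟨x, n, hx, rfl⟩ := ha
      induction ht using AddSubgroup.closure_induction with
      | zero => simp [zero_mem]
      | add a b _ _ ha hb => rw [mul_add]; exact add_mem ha hb
      | neg a _ ha => rw [mul_neg]; exact neg_mem ha
      | mem a ha =>
        obtain ⟨y, l, hy, rfl⟩ := ha
        exact AddSubgroup.subset_closure ⟨x * y, n * l, by
          rw [map_mul]; exact Set.mul_mem_mul hx hy, MonoidAlgebra.single_mul_single _ _ _ _⟩
  have T_Φ : ∀ (F : Set Q) (s : S), s ∈ T F → ∀ q, q ∉ F → Φ s q = 0 := by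
    intro F s hs q hq
    induction hs using AddSubgroup.closure_induction with
    | zero => simp
    | add a b _ _ ha hb => rw [map_add, Finsupp.add_apply, ha, hb, add_zero]
    | neg a _ ha => rw [map_neg, Finsupp.neg_apply, ha, neg_zero]
    | mem a ha =>
      obtain ⟨x, n, hx, rfl⟩ := ha
      have : Φ (single x n) = Finsupp.single (π x) (single (kp x) n) := Φ₀_single x n
      rw [this, Finsupp.single_apply, if_neg]
      rintro rfl
      exact hq hx
  have T_Ψ : ∀ (F : Set Q) (x : H), π x ∈ F → ∀ r, Ψ (π x) r ∈ T F := by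
    intro F x hx r
    rw [Ψ_def]
    induction r using MonoidAlgebra.induction_linear with
    | zero => simp [zero_mem]
    | add a b ha hb => rw [map_add, add_mul]; exact add_mem ha hb
    | single k n =>
      rw [ι_single, MonoidAlgebra.single_mul_single]
      exact AddSubgroup.subset_closure ⟨_, _, by
        rw [map_mul, MonoidHom.mem_ker.1 k.2, one_mul, sec_spec]; exact hx, rfl⟩
  have T_supp : ∀ (s : S) (F : Set Q), (∀ x ∈ s.coeff.support, π x ∈ F) → s ∈ T F := by
    intro s F h
    have e : s = ∑ x ∈ s.coeff.support, single x (s.coeff x) := by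
      apply MonoidAlgebra.coeff_injective
      rw [MonoidAlgebra.coeff_sum]
      exact (Finsupp.sum_single s.coeff).symm
    rw [e]
    exact sum_mem fun x hx => AddSubgroup.subset_closure ⟨x, _, h x hx, rfl⟩
  rw [strongRankCondition_iff_succ]
  intro n f hf
  let A : Finset Q := insert 1 (Finset.univ.biUnion fun p : Fin (n + 1) × Fin n =>
    (f (Pi.single p.1 1) p.2).coeff.support.image π)
  have hAr : ∀ q ∈ A, q ∈ π.range := by
    intro q hq
    rcases Finset.mem_insert.1 hq with rfl | hq
    · exact one_mem _
    · obtain ⟨p, -, hp⟩ := Finset.mem_biUnion.1 hq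
      obtain ⟨x, -, rfl⟩ := Finset.mem_image.1 hp
      exact ⟨x, rfl⟩
  have hAk : ∀ k : ℕ, ∀ q ∈ A ^ k, q ∈ π.range := by
    intro k
    induction k with
    | zero => intro q hq; rw [pow_zero, Finset.mem_one] at hq; rw [hq]; exact one_mem _
    | succ k ih =>
      intro q hq
      rw [pow_succ, Finset.mem_mul] at hq
      obtain ⟨y, hy, z, hz, rfl⟩ := hq
      exact mul_mem (ih y hy) (hAr z hz)
  obtain ⟨k, hk⟩ := exists_card_pow_succ_lt A n
  let E : (Fin (n + 1) × (A ^ k : Finset Q) → R) →ₗ[R] (Fin (n + 1) → S) :=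
    LinearMap.pi fun i => ∑ q : (A ^ k : Finset Q), (Ψ q).comp (LinearMap.proj (i, q))
  have E_def : ∀ c i, E c i = ∑ q : (A ^ k : Finset Q), Ψ q (c (i, q)) := fun c i => by
    simp [E]
  let fR : (Fin (n + 1) → S) →ₗ[R] (Fin n → S) :=
    { f.toAddMonoidHom with
      map_smul' := fun r v => by
        have : r • v = ι r • v := rfl
        change f (r • v) = _
        rw [this, map_smul]; rfl }
  let D : (Fin n → S) →ₗ[R] (Fin n × (A ^ (k + 1) : Finset Q) → R) :=
    LinearMap.pi fun p => (Finsupp.lapply (p.2 : Q)).comp (Φ.comp (LinearMap.proj p.1))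
  have hinj : Function.Injective (D.comp (fR.comp E)) := by
    rw [injective_iff_map_eq_zero]
    intro c hc
    have hT : ∀ i, E c i ∈ T (A ^ k : Finset Q) := fun i => by
      rw [E_def]
      refine sum_mem fun q _ => ?_
      obtain ⟨x, hx⟩ := hAk k q q.2
      rw [← hx]
      exact T_Ψ _ x (by rw [hx]; exact q.2) _
    have hT' : ∀ j, f (E c) j ∈ T (A ^ (k + 1) : Finset Q) := fun j => by
      have e : f (E c) = ∑ i, E c i • f (Pi.single i 1) := by
        conv_lhs => rw [pi_eq_sum_univ' (E c)]
        rw [map_sum]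
        refine Finset.sum_congr rfl fun i _ => ?_
        rw [map_smul]
      rw [e, Finset.sum_apply]
      refine sum_mem fun i _ => ?_
      rw [Pi.smul_apply, smul_eq_mul, pow_succ, Finset.coe_mul]
      refine T_mul _ _ _ _ (hT i) (T_supp _ _ fun x hx => ?_)
      exact Finset.mem_coe.2 (Finset.mem_insert_of_mem (Finset.mem_biUnion.2
        ⟨(i, j), Finset.mem_univ _, Finset.mem_image_of_mem _ hx⟩))
    have h0 : f (E c) = 0 := by
      ext1 j
      apply Φ_inj
      rw [Pi.zero_apply, map_zero]
      ext1 q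
      by_cases hq : q ∈ A ^ (k + 1)
      · exact congrFun hc (j, ⟨q, hq⟩)
      · exact T_Φ _ _ (hT' j) q hq
    have h1 : E c = 0 := hf (by rw [h0, map_zero])
    ext1 ⟨i, q⟩
    have h2 : Φ (E c i) q = 0 := by rw [h1]; simp
    have h3 : ∀ q' : (A ^ k : Finset Q), Φ (Ψ q' (c (i, q'))) =
        Finsupp.single (q' : Q) (c (i, q')) := fun q' => by
      obtain ⟨x, hx⟩ := hAk k q' q'.2
      rw [← hx]
      exact ΦΨ x _
    rw [E_def, map_sum, Finset.sum_congr rfl fun q' _ => h3 q', Finsupp.finsetSum_apply,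
      Finset.sum_eq_single q] at h2
    · simpa using h2
    · intro b _ hb
      rw [Finsupp.single_apply, if_neg fun h => hb (Subtype.ext h)]
    · simp
  have := card_le_of_injective R (D.comp (fR.comp E)) hinj
  simp only [Fintype.card_prod, Fintype.card_fin, Fintype.card_coe] at this
  omega

theorem strongRankCondition_of_ringEquiv {R S : Type*} [Ring R] [Ring S] (e : R ≃+* S)
    (h : StrongRankCondition S) : StrongRankCondition R := by
  rw [strongRankCondition_iff_succ]
  intro n f hf
  let g : (Fin (n + 1) → S) →ₗ[S] (Fin n → S) :=
    { toFun := fun v j => e (f (fun i => e.symm (v i)) j)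
      map_add' := fun v w => by
        ext1 j
        have h : (fun i => e.symm ((v + w) i)) = (fun i => e.symm (v i)) + fun i => e.symm (w i) := by
          ext1 i; simp
        rw [h, map_add]
        simp
      map_smul' := fun r v => by
        ext1 j
        have h : (fun i => e.symm ((r • v) i)) = e.symm r • fun i => e.symm (v i) := by
          ext1 i; simp
        rw [h, map_smul]
        simp }
  refine strongRankCondition_iff_succ S |>.1 h n g fun v w hvw => ?_
  have h1 : (fun i => e.symm (v i)) = fun i => e.symm (w i) :=
    hf (funext fun j => e.injective (congrFun hvw j))
  exact funext fun i => e.symm.injective (congrFun h1 i)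

theorem groupRing_extension {H : Type*} [Group H] (N : Subgroup H) [N.Normal]
    (hcomm : ∀ a b : H, a * b * a⁻¹ * b⁻¹ ∈ N) (htf : ∀ (g : H) (k : ℕ), k ≠ 0 → g ^ k ∈ N → g ∈ N)
    (h1 : UniqueProds N) (h2 : StrongRankCondition (MonoidAlgebra ℤ N)) :
    UniqueProds H ∧ StrongRankCondition (MonoidAlgebra ℤ H) := by
  let _ : CommGroup (H ⧸ N) :=
    { (inferInstance : Group (H ⧸ N)) with
      mul_comm := by
        rintro ⟨a⟩ ⟨b⟩
        refine QuotientGroup.eq.2 ?_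
        simpa [mul_assoc] using hcomm b⁻¹ a⁻¹ }
  have : IsMulTorsionFree (H ⧸ N) := by
    refine ⟨fun k hk => ?_⟩
    rintro ⟨a⟩ ⟨b⟩ hab
    have hab' : ((a : H ⧸ N)) ^ k = (b : H ⧸ N) ^ k := hab
    refine QuotientGroup.eq.2 (htf _ k hk ?_)
    rw [← QuotientGroup.eq_one_iff, QuotientGroup.mk_pow, QuotientGroup.mk_mul,
      QuotientGroup.mk_inv, mul_pow, inv_pow, hab', inv_mul_cancel]
  have : UniqueProds (H ⧸ N) := uniqueProds_of_torsionFree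
  have hker := QuotientGroup.ker_mk' N
  exact ⟨uniqueProds_of_ker (QuotientGroup.mk' N) (by rw [hker]; exact h1),
    strongRankCondition_of_ker (QuotientGroup.mk' N) (by rw [hker]; exact h2)⟩

theorem rationalDerivedSeries_antitone (G : Type*) [Group G] :
    Antitone (rationalDerivedSeries G) :=
  antitone_nat_of_succ_le fun _ => rationalCommutator_le _

theorem groupRing_of_filtration {Γ : Type*} [Group Γ] (M : ℕ → Subgroup Γ) (m : ℕ)
    (hM : M m = ⊥) (hle : ∀ i < m, M (i + 1) ≤ M i) (hn : ∀ i, (M i).Normal)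
    (hc : ∀ i < m, ⁅M i, M i⁆ ≤ M (i + 1))
    (ht : ∀ i < m, ∀ g ∈ M i, ∀ k : ℕ, k ≠ 0 → g ^ k ∈ M (i + 1) → g ∈ M (i + 1)) (k : ℕ) :
    ∀ n : ℕ, n + k = m → ∀ (H : Subgroup Γ), H ≤ M n →
      UniqueProds H ∧ StrongRankCondition (MonoidAlgebra ℤ H) := by
  induction k with
  | zero =>
    rintro n rfl H hH
    have h : H = ⊥ := le_bot_iff.1 (hH.trans hM.le)
    subst h
    let _ : CommGroup (⊥ : Subgroup Γ) :=
      { (inferInstance : Group (⊥ : Subgroup Γ)) with mul_comm := fun a b => Subsingleton.elim _ _ }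
    have : IsMulTorsionFree (⊥ : Subgroup Γ) := ⟨fun _ _ => Function.injective_of_subsingleton _⟩
    refine ⟨uniqueProds_of_torsionFree, ?_⟩
    exact commRing_strongRankCondition (MonoidAlgebra ℤ (⊥ : Subgroup Γ))
  | succ k ih =>
    intro n hnk H hH
    have hlt : n < m := by omega
    obtain ⟨h1, h2⟩ := ih (n + 1) (by omega) (H ⊓ M (n + 1)) inf_le_right
    let N : Subgroup H := (M (n + 1)).subgroupOf H
    have := hn (n + 1)
    let e : N ≃* (H ⊓ M (n + 1) : Subgroup Γ) :=
      { toFun := fun x => ⟨x.1.1, x.1.2, x.2⟩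
        invFun := fun x => ⟨⟨x.1, x.2.1⟩, x.2.2⟩
        left_inv := fun _ => rfl
        right_inv := fun _ => rfl
        map_mul' := fun _ _ => rfl }
    refine groupRing_extension N (fun a b => ?_) (fun g k hk h => ?_) ?_ ?_
    · exact hc n hlt (Subgroup.commutator_mem_commutator (hH a.2) (hH b.2))
    · exact ht n hlt g (hH g.2) k hk (by simpa [N, Subgroup.mem_subgroupOf] using h)
    · exact e.uniqueProds_iff.2 h1
    · let e' := MonoidAlgebra.mapDomainRingEquiv ℤ e
      exact strongRankCondition_of_ringEquiv e' h2

/-- A subgroup of `G / G_r^(m)` has unique products and its integral group ring satisfies the strong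
rank condition; hence this group ring is a domain satisfying the Ore condition. -/
theorem groupRing_rationalDerivedQuotient {G : Type*} [Group G] (m : ℕ)
    (H : Subgroup (G ⧸ rationalDerivedSeries G m)) :
    UniqueProds H ∧ StrongRankCondition (MonoidAlgebra ℤ H) := by
  let q := QuotientGroup.mk' (rationalDerivedSeries G m)
  refine groupRing_of_filtration (fun i => (rationalDerivedSeries G i).map q) m ?_ ?_ ?_ ?_ ?_ m 0
    (zero_add m) H ?_
  · exact (Subgroup.map_eq_bot_iff _).2 (QuotientGroup.ker_mk' _).ge
  · exact fun i _ => Subgroup.map_mono (rationalDerivedSeries_antitone G i.le_succ)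
  · exact fun i => Subgroup.Normal.map inferInstance _ (QuotientGroup.mk'_surjective _)
  · intro i _
    rw [← Subgroup.map_commutator]
    exact Subgroup.map_mono (commutator_le_rationalCommutator _)
  · rintro i hi _ ⟨a, ha, rfl⟩ k hk ⟨b, hb, hab⟩
    refine ⟨a, ⟨ha, ?_⟩, rfl⟩
    have h1 : b⁻¹ * a ^ k ∈ rationalDerivedSeries G (i + 1) :=
      rationalDerivedSeries_antitone G hi (QuotientGroup.eq.1 (hab.trans (map_pow q a k).symm))
    have h2 : a ^ k ∈ rationalDerivedSeries G (i + 1) := by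
      simpa using mul_mem (SetLike.mem_coe.1 hb) h1
    obtain ⟨-, l, hl, h⟩ := h2
    exact ⟨k * l, by positivity, by rwa [zpow_mul, zpow_natCast]⟩
  · rw [show rationalDerivedSeries G 0 = ⊤ from rfl,
      Subgroup.map_top_of_surjective _ (QuotientGroup.mk'_surjective _)]
    exact le_top

/-! ### Higher-order degrees of a group -/

noncomputable section HigherOrderDegree

variable (G : Type*) [Group G] (n : ℕ)

/-- `Γ_n = G / G_r^(n+1)`. -/
abbrev RationalSolvableQuotient : Type _ := G ⧸ rationalDerivedSeries G (n + 1)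

/-- The conjugation action of `G` on `G_r^(n+1) / [G_r^(n+1), G_r^(n+1)]`, `g • [h] = [g h g⁻¹]`. -/
def conjOnAbelianization : G →*
    Module.End ℤ (Additive (Abelianization (rationalDerivedSeries G (n + 1)))) where
  toFun g := (MonoidHom.toAdditive
    (Abelianization.map (MulAut.conjNormal g).toMonoidHom)).toIntLinearMap
  map_one' := by
    ext x
    obtain ⟨x, rfl⟩ := QuotientGroup.mk_surjective x
    exact congrArg (fun y => Additive.ofMul (Abelianization.of y)) (Subtype.ext (by simp))
  map_mul' g h := by
    ext x
    obtain ⟨x, rfl⟩ := QuotientGroup.mk_surjective x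
    exact congrArg (fun y => Additive.ofMul (Abelianization.of y))
      (Subtype.ext (by simp [mul_assoc]))

theorem rationalDerivedSeries_le_ker_conj :
    rationalDerivedSeries G (n + 1) ≤ (conjOnAbelianization G n).ker := by
  intro g hg
  rw [MonoidHom.mem_ker]
  ext x
  obtain ⟨x, rfl⟩ := QuotientGroup.mk_surjective x
  have h : MulAut.conjNormal g x = ⟨g, hg⟩ * x * ⟨g, hg⟩⁻¹ := Subtype.ext (by simp)
  refine congrArg Additive.ofMul
    (show Abelianization.of (MulAut.conjNormal g x) = Abelianization.of x from ?_)
  rw [h, map_mul, map_mul, map_inv, mul_right_comm, mul_inv_cancel, one_mul]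

/-- The `n`-th order Alexander module `G_r^(n+1) / [G_r^(n+1), G_r^(n+1)]` with its `ℤ[Γ_n]`-module
structure by conjugation, given as a representation of `Γ_n` over `ℤ`. For `G = π₁(X)` it is the
first homology, with its deck group action, of the regular cover of `X` with group `Γ_n`. -/
def alexanderModule : Representation ℤ (RationalSolvableQuotient G n)
    (Additive (Abelianization (rationalDerivedSeries G (n + 1)))) :=
  QuotientGroup.lift _ (conjOnAbelianization G n) (rationalDerivedSeries_le_ker_conj G n)

variable {G} (ψ : G →* Multiplicative ℤ)

/-- The kernel of the homomorphism `Γ_n → ℤ` induced by `ψ : G → ℤ`. -/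
def kerSubgroup : Subgroup (RationalSolvableQuotient G n) :=
  (QuotientGroup.lift _ ψ (rationalDerivedSeries_succ_le_ker ψ n)).ker

/-- The integral group ring of `ker (Γ_n → ℤ)`. -/
abbrev KerGroupRing : Type _ := MonoidAlgebra ℤ (kerSubgroup n ψ)

instance uniqueProds_kerSubgroup : UniqueProds (kerSubgroup n ψ) := (groupRing_rationalDerivedQuotient _ _).1

instance strongRankCondition_kerGroupRing : StrongRankCondition (KerGroupRing n ψ) := (groupRing_rationalDerivedQuotient _ _).2

open nonZeroDivisors in
/-- The nonzero elements of `ℤ[ker (Γ_n → ℤ)]` form an Ore set. -/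
instance oreSet_kerGroupRing : OreLocalization.OreSet (KerGroupRing n ψ)⁰ :=
  nonempty_oreSet_of_strongRankCondition.some

open nonZeroDivisors in
/-- The skew field of fractions `𝕂_n` of the Ore domain `ℤ[ker (Γ_n → ℤ)]`. -/
abbrev KerSkewField : Type _ := OreLocalization (KerGroupRing n ψ)⁰ (KerGroupRing n ψ)

open nonZeroDivisors in
/-- The localized Alexander module: the `n`-th order Alexander module, restricted to
`ℤ[ker (Γ_n → ℤ)]`, with all nonzero elements of this ring inverted. As a vector space over `𝕂_n`
it is `𝕂_n ⊗ A` (tensor product over `ℤ[ker (Γ_n → ℤ)]`), `A` the Alexander module. -/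
abbrev LocalizedAlexanderModule : Type _ :=
  OreLocalization (KerGroupRing n ψ)⁰
    (Representation.asModule ((alexanderModule G n).comp (kerSubgroup n ψ).subtype))

/-- The `n`-th order degree `δ_n` of the group `G` with respect to `ψ : G → ℤ`: the rank over `𝕂_n`
of the localized `n`-th order Alexander module. -/
def higherOrderDegree : Cardinal :=
  Module.rank (KerSkewField n ψ) (LocalizedAlexanderModule n ψ)

end HigherOrderDegree

/-! ### Line arrangements in `ℂ²` and the total linking number -/

noncomputable section LineArrangement

/-- The isomorphism `2πi ℤ ≃ ℤ` sending `2πi` to `1`. -/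
def zmultiplesTwoPiI : AddSubgroup.zmultiples (2 * Real.pi * Complex.I) ≃+ ℤ :=
  ((AddMonoidHom.ofInjective (f := zmultiplesHom ℂ (2 * Real.pi * Complex.I)) (by
    intro a b hab
    simpa using hab)).trans (AddEquiv.addSubgroupCongr (by
      ext; simp [AddSubgroup.mem_zmultiples_iff]))).symm

/-- The isomorphism from the fundamental group of the punctured plane `ℂ ∖ {0}` to `ℤ` sending a loop
to its winding number about `0`: a loop lifts through `exp` to a path whose end point differs from
its starting point by `2πi` times the winding number (see `windingHom_mk`). -/
def windingHom (z : {z : ℂ // z ≠ 0}) :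
    FundamentalGroup {z : ℂ // z ≠ 0} z →* Multiplicative ℤ :=
  ((MulOpposite.opMulEquiv.symm.trans zmultiplesTwoPiI.toMultiplicative).toMonoidHom).comp
    (Complex.isAddQuotientCoveringMap_exp.fundamentalGroupToMulOpposite
      ⟨Complex.log z, Subtype.ext (Complex.exp_log z.2)⟩)

theorem windingHom_mk (z : {z : ℂ // z ≠ 0}) (γ : Path z z) (θ : C(unitInterval, ℂ))
    (h : ∀ t, Complex.exp (θ t) = γ t) (k : ℤ) (hk : θ 1 - θ 0 = k * (2 * Real.pi * Complex.I)) :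
    windingHom z (FundamentalGroup.fromPath (Path.Homotopic.Quotient.mk γ)) =
      Multiplicative.ofAdd k := by
  have cov := Complex.isAddQuotientCoveringMap_exp.isCoveringMap
  let e : (fun z : ℂ ↦ (⟨_, z.exp_ne_zero⟩ : {z : ℂ // z ≠ 0})) ⁻¹' {z} :=
    ⟨Complex.log z, Subtype.ext (Complex.exp_log z.2)⟩
  let c : AddSubgroup.zmultiples (2 * Real.pi * Complex.I) := zmultiplesTwoPiI.symm k
  have hc : (c : ℂ) = k * (2 * Real.pi * Complex.I) := by
    change k • (2 * Real.pi * Complex.I) = _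
    rw [zsmul_eq_mul]
  have key : Complex.isAddQuotientCoveringMap_exp.fundamentalGroupToMulOpposite e
      (FundamentalGroup.fromPath (Path.Homotopic.Quotient.mk γ)) =
      MulOpposite.op (Multiplicative.ofAdd c) := by
    rw [IsAddQuotientCoveringMap.fundamentalGroupToMulOpposite_apply_eq_Iff]
    let θ' : C(unitInterval, ℂ) := ⟨fun t => θ t + (Complex.log z - θ 0), by fun_prop⟩
    have h0 : Complex.exp (Complex.log z - θ 0) = 1 := by
      rw [Complex.exp_sub, Complex.exp_log z.2, h 0, γ.source, div_self z.2]
    have hθ' : θ' = cov.liftPath γ (Complex.log z) (γ.source.trans e.2.symm) := by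
      rw [cov.eq_liftPath_iff']
      refine ⟨?_, by simp [θ']⟩
      ext t
      simp [θ', Complex.exp_add, h0, h]
    change (c : ℂ) + Complex.log z = cov.liftPath γ (Complex.log z) _ 1
    rw [← hθ', hc, ← hk]
    simp only [θ', ContinuousMap.coe_mk]
    ring
  have : windingHom z (FundamentalGroup.fromPath (Path.Homotopic.Quotient.mk γ)) =
      Multiplicative.ofAdd (zmultiplesTwoPiI (MulOpposite.unop
        (Complex.isAddQuotientCoveringMap_exp.fundamentalGroupToMulOpposite e
          (FundamentalGroup.fromPath (Path.Homotopic.Quotient.mk γ)))).toAdd) := rfl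
  rw [this, key]
  simp [c]

/-- The complement `U` in `ℂ²` of the lines `{ℓ i = 0}`. -/
def linesComplement {ι : Type*} (ℓ : ι → (ℂ × ℂ) →ᵃ[ℂ] ℂ) : Set (ℂ × ℂ) := {z | ∀ i, ℓ i z ≠ 0}

/-- The equation `ℓ i` of the `i`-th line as a nowhere vanishing function on the complement. -/
def lineEquation {ι : Type*} (ℓ : ι → (ℂ × ℂ) →ᵃ[ℂ] ℂ) (i : ι) :
    C(linesComplement ℓ, {z : ℂ // z ≠ 0}) where
  toFun z := ⟨ℓ i z, z.2 i⟩
  continuous_toFun := by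
    have := (ℓ i).continuous_of_finiteDimensional
    fun_prop

/-- The total linking number homomorphism `ψ : π₁(U, x) → ℤ`: the linking number of a loop with the
line `{ℓ i = 0}` is the winding number about `0` of its image under `ℓ i`, and `ψ` is the sum of
these linking numbers over all lines. It sends the meridian of each line to `1`. -/
def totalLinkingHom {ι : Type*} [Fintype ι] (ℓ : ι → (ℂ × ℂ) →ᵃ[ℂ] ℂ) (x : linesComplement ℓ) :
    FundamentalGroup (linesComplement ℓ) x →* Multiplicative ℤ :=
  ∏ i, (windingHom (lineEquation ℓ i x)).comp (FundamentalGroup.map (lineEquation ℓ i) x)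

end LineArrangement

/-! The complement is a product. Let `u` be an equation of the first line, `p` the common point, and
`w` the slope of the complex line joining a point of `U` to `p`. Then `(u, w)` identifies `U` with
`ℂ ∖ {0}` times the plane minus `k = m - 1` points, so `G ≃ F_k × ℤ`
(`exists_fundamentalGroup_linesComplement_mulEquiv`). The generator `c` of the factor `ℤ` is the
loop rotating a point about `p`. It winds once around every line, so `ψ(c) = m`. An explicit loop
around a single line shows that `ψ` is onto.

That the punctured plane has free fundamental group is a van Kampen argument for two simply
connected open sets, the complements of the upward and of the downward rays at the punctures, which
meet in `k + 1` strips. Loops that go out in one set and return in the other through a given strip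
generate the group. They satisfy no relation, because a covering glued from two charts lets them act
as left translations on a copy of `F_k`.

For the degree, `G_r^(n+1)` dies under every homomorphism to `ℤ`, hence maps isomorphically onto a
normal subgroup `N` of `F_k`. With `Q = F_k / N`, the Alexander module is the relation module `Nᵃᵇ`,
and Fox calculus gives an exact sequence `0 → Nᵃᵇ → ℤ[Q]^k → ℤ[Q]` whose last map has the
augmentation ideal as its image (`relationMap_injective`, `relationMap_exact`). Since `ψ(c) = m` and
`ψ` is onto, the kernel of `Γ_n → ℤ` embeds in `Q` with index `m`. Over its group ring the two
permutation modules are therefore free of ranks `mk` and `m`. That kernel is nontrivial, so the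
cokernel is torsion. Ore localization is exact, whence `δ_n + m = m(m - 1)`, that is, `δ_n = m(m -
2)`. -/

/-! ### Exactness and ranks of Ore localizations -/

open nonZeroDivisors

namespace OreLocalization

section

variable {R : Type*} [Ring R] (S : Submonoid R) [OreSet S]
variable {M N : Type*} [AddCommGroup M] [Module R M] [AddCommGroup N] [Module R N]

/-- The map of Ore localizations induced by a linear map. -/
noncomputable def mapLinear (f : M →ₗ[R] N) :
    OreLocalization S M →ₗ[OreLocalization S R] OreLocalization S N where
  toFun := liftExpand (fun x s => f x /ₒ s) fun x t s ht => by
    rw [map_smul]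
    exact OreLocalization.expand (f x) s t ht
  map_add' x y := by
    induction x using OreLocalization.ind with | _ x s
    induction y using OreLocalization.ind with | _ y t
    obtain ⟨r, u, h, e⟩ := oreDivAddChar' x y s t
    rw [e, liftExpand_of, liftExpand_of, liftExpand_of, oreDiv_add_char s t r u h]
    simp only [Submonoid.smul_def, map_add, map_smul]
  map_smul' a y := by
    induction a using OreLocalization.ind with | _ a s
    induction y using OreLocalization.ind with | _ y t
    obtain ⟨r, u, h, e⟩ := oreDivSMulChar' a y s t
    rw [e, liftExpand_of, RingHom.id_apply, liftExpand_of, map_smul,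
      oreDiv_smul_char a (f y) s t r u h]

@[simp] theorem mapLinear_oreDiv (f : M →ₗ[R] N) (x : M) (s : S) :
    mapLinear S f (x /ₒ s) = f x /ₒ s := rfl

end

variable {R : Type*} [Ring R] [IsDomain R] [OreSet R⁰]

/-- Localizing at all nonzero elements of a domain kills exactly the torsion elements. This is what
turns exactness up to torsion into exactness over the skew field. -/
theorem oreDiv_eq_zero_iff {M : Type*} [AddCommGroup M] [Module R M] {x : M} {s : R⁰} :
    x /ₒ s = 0 ↔ ∃ r : R, r ≠ 0 ∧ r • x = 0 := by
  rw [OreLocalization.zero_def, oreDiv_eq_iff]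
  constructor
  · rintro ⟨u, v, h, h'⟩
    refine ⟨v, ?_, by rw [← h, smul_zero]⟩
    rintro rfl
    exact nonZeroDivisors.coe_ne_zero u (by simp at h')
  · rintro ⟨r, hr, h⟩
    exact ⟨⟨r * s, mul_mem (mem_nonZeroDivisors_of_ne_zero hr) s.2⟩, r, by rw [h, smul_zero],
      by simp⟩

universe u

variable {A M C : Type u} [AddCommGroup A] [Module R A] [AddCommGroup M] [Module R M]
  [AddCommGroup C] [Module R C]

/-- Additivity of the rank of Ore localizations along sequences `0 → A → M → C` that are exact and
have a torsion cokernel. -/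
theorem rank_add_rank_of_exact (f : A →ₗ[R] M) (g : M →ₗ[R] C) (hf : Function.Injective f)
    (hfg : Function.Exact f g) (hg : ∀ c, ∃ r : R, r ≠ 0 ∧ r • c ∈ LinearMap.range g) :
    Module.rank (OreLocalization R⁰ R) (OreLocalization R⁰ A) +
      Module.rank (OreLocalization R⁰ R) (OreLocalization R⁰ C) =
      Module.rank (OreLocalization R⁰ R) (OreLocalization R⁰ M) := by
  have h1 : Function.Injective (mapLinear R⁰ f) := by
    rw [injective_iff_map_eq_zero]
    intro x hx
    induction x using OreLocalization.ind with | _ x s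
    rw [mapLinear_oreDiv, oreDiv_eq_zero_iff] at hx
    obtain ⟨r, hr, h⟩ := hx
    rw [oreDiv_eq_zero_iff]
    exact ⟨r, hr, hf (by rw [map_smul, h, map_zero])⟩
  have h2 : LinearMap.range (mapLinear R⁰ f) = LinearMap.ker (mapLinear R⁰ g) := by
    apply le_antisymm
    · rintro _ ⟨x, rfl⟩
      induction x using OreLocalization.ind with | _ x s
      rw [LinearMap.mem_ker, mapLinear_oreDiv, mapLinear_oreDiv, hfg.apply_apply_eq_zero, zero_oreDiv]
    · intro x hx
      induction x using OreLocalization.ind with | _ x s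
      rw [LinearMap.mem_ker, mapLinear_oreDiv, oreDiv_eq_zero_iff] at hx
      obtain ⟨r, hr, h⟩ := hx
      rw [← map_smul] at h
      -- The numerator `x` need not come from `A`, but its multiple `r • x` does; the factor `r` is
      -- absorbed into the denominator.
      obtain ⟨a, ha⟩ := (hfg _).1 h
      have hr' : r * (s : R) ∈ R⁰ := mul_mem (mem_nonZeroDivisors_of_ne_zero hr) s.2
      refine ⟨a /ₒ ⟨r * s, hr'⟩, ?_⟩
      rw [mapLinear_oreDiv, ha, ← OreLocalization.expand]
  have h3 : LinearMap.range (mapLinear R⁰ g) = ⊤ := by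
    rw [LinearMap.range_eq_top]
    intro x
    induction x using OreLocalization.ind with | _ c s
    obtain ⟨r, hr, y, hy⟩ := hg c
    have hr' : r * (s : R) ∈ R⁰ := mul_mem (mem_nonZeroDivisors_of_ne_zero hr) s.2
    refine ⟨y /ₒ ⟨r * s, hr'⟩, ?_⟩
    rw [mapLinear_oreDiv, hy, ← OreLocalization.expand]
  rw [← LinearMap.rank_range_add_rank_ker (mapLinear R⁰ g), h3, rank_top, ← h2,
    ← (LinearEquiv.ofInjective _ h1).rank_eq, add_comm]

theorem rank_eq_of_linearEquiv (e : A ≃ₗ[R] M) :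
    Module.rank (OreLocalization R⁰ R) (OreLocalization R⁰ A) =
      Module.rank (OreLocalization R⁰ R) (OreLocalization R⁰ M) := by
  have h := rank_add_rank_of_exact e.toLinearMap (0 : M →ₗ[R] PUnit.{u + 1}) e.injective
    (fun y => ⟨fun _ => e.surjective y, fun _ => Subsingleton.elim _ _⟩)
    (fun c => ⟨1, one_ne_zero, 0, Subsingleton.elim _ _⟩)
  have : Subsingleton (OreLocalization R⁰ PUnit.{u + 1}) := by
    refine subsingleton_of_forall_eq 0 fun x => ?_
    induction x using OreLocalization.ind with | _ c s
    rw [Subsingleton.elim c 0, zero_oreDiv]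
  rwa [rank_subsingleton' _ (OreLocalization R⁰ PUnit.{u + 1}), add_zero] at h

end OreLocalization

namespace OreLocalization

universe u

variable {R : Type u} [Ring R] [IsDomain R] [OreSet R⁰]

/-- Induction by splitting off coordinate `0`: the sequence `R → R^(n+1) → R^n` is exact and ranks
add. -/
theorem rank_fin_fun (n : ℕ) :
    Module.rank (OreLocalization R⁰ R) (OreLocalization R⁰ (Fin n → R)) = n := by
  induction n with
  | zero =>
    have : Subsingleton (OreLocalization R⁰ (Fin 0 → R)) := by
      refine subsingleton_of_forall_eq 0 fun x => ?_
      induction x using OreLocalization.ind with | _ c s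
      rw [Subsingleton.elim c 0, zero_oreDiv]
    rw [rank_subsingleton', Nat.cast_zero]
  | succ n ih =>
    have h := rank_add_rank_of_exact (LinearMap.single R (fun _ : Fin (n + 1) => R) 0)
      (LinearMap.funLeft R R Fin.succ)
      (Pi.single_injective (M := fun _ : Fin (n + 1) => R) 0) (fun y => ?_)
      (fun c => ⟨1, one_ne_zero, Fin.cons 0 c, by ext; simp [LinearMap.funLeft]⟩)
    · rw [← h, ih, Module.rank_self, Nat.cast_succ, add_comm]
    · constructor
      · intro hy
        refine ⟨y 0, funext fun i => ?_⟩
        refine Fin.cases ?_ (fun i => ?_) i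
        · simp
        · simpa using (congrFun hy i).symm
      · rintro ⟨r, rfl⟩
        ext i
        simp [LinearMap.funLeft]

theorem rank_of_basis {M ι : Type u} [AddCommGroup M] [Module R M] [Fintype ι] (b : Module.Basis ι R M) :
    Module.rank (OreLocalization R⁰ R) (OreLocalization R⁰ M) = Fintype.card ι := by
  rw [rank_eq_of_linearEquiv ((b.reindex (Fintype.equivFin ι)).equivFun), rank_fin_fun]

end OreLocalization

/-! ### Permutation modules of free actions -/

section PermutationModule

variable {H Q X : Type*} [Group H] [Group Q]

/-- The permutation representation of a group `Q` on `ℤ[Q × X]`. -/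
noncomputable def translationRep (Q X : Type*) [Group Q] : Representation ℤ Q (Q × X →₀ ℤ) where
  toFun g := Finsupp.lmapDomain ℤ ℤ fun p => (g * p.1, p.2)
  map_one' := by ext; simp
  map_mul' g h := by ext; simp [mul_assoc]

@[simp] theorem translationRep_single (g : Q) (p : Q × X) (n : ℤ) :
    translationRep Q X g (Finsupp.single p n) = Finsupp.single (g * p.1, p.2) n := by
  simp [translationRep]

/-- If `Q` is a disjoint union of right cosets `φ(H) qⱼ` of an injective image of `H`, then
`ℤ[Q × X]` is a free `ℤ[H]`-module on `J × X`. -/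
noncomputable def translationRepBasis {J : Type*} (φ : H →* Q) (q : J → Q)
    (hq : Function.Bijective fun p : J × H => φ p.2 * q p.1) :
    Module.Basis (J × X) (MonoidAlgebra ℤ H)
      (Representation.asModule ((translationRep Q X).comp φ)) := by
  let σ : Representation ℤ H (Q × X →₀ ℤ) := (translationRep Q X).comp φ
  let e : (J × X) × H ≃ Q × X := Equiv.ofBijective (fun p => (φ p.2 * q p.1.1, p.1.2)) (by
    constructor
    · rintro ⟨⟨j, x⟩, h⟩ ⟨⟨j', x'⟩, h'⟩ h0
      have h1 := congrArg Prod.fst h0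
      have h2 := congrArg Prod.snd h0
      have h3 := @hq.1 (j, h) (j', h') h1
      simp_all
    · rintro ⟨y, x⟩
      obtain ⟨⟨j, h⟩, rfl⟩ := hq.2 y
      exact ⟨⟨⟨j, x⟩, h⟩, rfl⟩)
  let f : J × X → (Q × X →₀ ℤ) := fun p => Finsupp.single (q p.1, p.2) 1
  have hf : Function.Bijective (Representation.freeLift σ f) := by
    -- On the underlying abelian groups the free lift only relabels the standard basis along the
    -- bijection `e`, so it is bijective.
    have h1 : Finsupp.linearCombination ℤ (fun x : (J × X) × H => σ x.2 (f x.1)) =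
        (Finsupp.domLCongr e : _ ≃ₗ[ℤ] _).toLinearMap := by
      ext x : 2
      simp [σ, f]
      rfl
    have h2 : (Representation.freeLift σ f : (J × X →₀ MonoidAlgebra ℤ H) → (Q × X →₀ ℤ)) =
        Finsupp.domLCongr (M := ℤ) (R := ℤ) e ∘ (Finsupp.curryLinearEquiv ℤ).symm ∘
          Finsupp.mapRange.linearEquiv (MonoidAlgebra.coeffLinearEquiv ℤ) := by
      funext v
      change Finsupp.linearCombination ℤ _ _ = _
      rw [h1]
      rfl
    rw [h2]
    exact (LinearEquiv.bijective _).comp ((LinearEquiv.bijective _).comp (LinearEquiv.bijective _))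
  exact (Representation.freeAsModuleBasis ℤ H (J × X)).map
    (LinearEquiv.ofBijective (Representation.IntertwiningMap.equivLinearMapAsModule _ _
      (Representation.freeLift σ f)) hf)

end PermutationModule

/-! ### The relation module of a free group extension -/

namespace RelationModule

section Fox

variable {X Q : Type*} [Group Q] (π : FreeGroup X →* Q)

/-- The affine action of a free group on `ℤ[Q × X]` whose translation part is given by the Fox
derivatives. -/
noncomputable def foxPerm : FreeGroup X →* Equiv.Perm (Q × X →₀ ℤ) :=
  FreeGroup.lift fun x =>
    { toFun v := Finsupp.single (1, x) 1 + translationRep Q X (π (.of x)) v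
      invFun v := translationRep Q X (π (.of x))⁻¹ (v - Finsupp.single (1, x) 1)
      left_inv v := by
        simp only [add_sub_cancel_left]
        rw [Representation.inv_self_apply]
      right_inv v := by
        simp only [Representation.self_inv_apply, add_sub_cancel] }

/-- The total Fox derivative `f ↦ ∑ₓ (∂f/∂x) eₓ` with coefficients in `ℤ[Q]`. -/
noncomputable def fox (f : FreeGroup X) : Q × X →₀ ℤ := foxPerm π f 0

@[simp] theorem fox_one : fox π 1 = 0 := by simp [fox]

@[simp] theorem fox_of (x : X) : fox π (.of x) = Finsupp.single (1, x) 1 := by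
  simp [fox, foxPerm]

/-- Each `f` acts as an affine map with linear part `π f` and translation part `fox π f`. Affine
permutations compose, so the universal property of the free group yields the derivation without a
choice of words. -/
theorem foxPerm_apply (f : FreeGroup X) :
    ∀ v, foxPerm π f v = fox π f + translationRep Q X (π f) v := by
  induction f using FreeGroup.induction_on with
  | C1 => intro v; simp
  | of x => intro v; simp [fox, foxPerm]
  | inv_of x ih =>
    intro v
    apply (foxPerm π (.of x)).injective
    have h : ∀ w, foxPerm π (.of x) (foxPerm π (.of x)⁻¹ w) = w := fun w => by
      rw [← Equiv.Perm.mul_apply, ← map_mul, mul_inv_cancel, map_one, Equiv.Perm.one_apply]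
    rw [h, ih, map_add, map_inv, Representation.self_inv_apply, ← add_assoc, ← ih, fox, h, zero_add]
  | mul f g hf hg =>
    intro v
    have h : fox π (f * g) = fox π f + translationRep Q X (π f) (fox π g) := by
      rw [fox, map_mul, Equiv.Perm.mul_apply, hf, ← fox]
    rw [map_mul, Equiv.Perm.mul_apply, hg, hf, h, map_add, map_mul, map_mul, add_assoc]
    rfl

/-- The Fox product rule: the translation part of a composite of affine maps is a crossed
homomorphism. On `ker π` it becomes additive. -/
theorem fox_mul (f g : FreeGroup X) :
    fox π (f * g) = fox π f + translationRep Q X (π f) (fox π g) := by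
  rw [fox, map_mul, Equiv.Perm.mul_apply, foxPerm_apply, ← fox]

theorem fox_inv (f : FreeGroup X) :
    fox π f⁻¹ = - translationRep Q X (π f⁻¹) (fox π f) := by
  have h := fox_mul π f⁻¹ f
  rw [inv_mul_cancel, fox_one] at h
  exact eq_neg_of_add_eq_zero_left h.symm

theorem fox_mul_inv_of_eq {f g : FreeGroup X} (h : π f = π g) :
    fox π (f * g⁻¹) = fox π f - fox π g := by
  rw [fox_mul, fox_inv, map_neg, map_inv, h, Representation.self_inv_apply, sub_eq_add_neg]

/-- For `n` in `ker π` the contributions of `f` and `f⁻¹` cancel. This is the equivariance that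
makes the relation module a submodule of `ℤ[Q × X]`. -/
theorem fox_conj (f : FreeGroup X) (n : π.ker) :
    fox π (f * n * f⁻¹) = translationRep Q X (π f) (fox π n) := by
  rw [fox_mul_inv_of_eq π (by rw [map_mul, MonoidHom.mem_ker.1 n.2, mul_one]), fox_mul,
    add_sub_cancel_left]

/-- The boundary `ℤ[Q × X] → ℤ[Q]`, `(q, x) ↦ q π(x) - q`. -/
noncomputable def cayleyBoundary : (Q × X →₀ ℤ) →ₗ[ℤ] (Q × Unit →₀ ℤ) :=
  Finsupp.linearCombination ℤ fun p => Finsupp.single (p.1 * π (.of p.2), ()) 1 -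
    Finsupp.single (p.1, ()) 1

@[simp] theorem cayleyBoundary_single (q : Q) (x : X) (n : ℤ) :
    cayleyBoundary π (Finsupp.single (q, x) n) =
      Finsupp.single (q * π (.of x), ()) n - Finsupp.single (q, ()) n := by
  simp [cayleyBoundary, smul_sub]

theorem cayleyBoundary_translationRep (q : Q) (v : Q × X →₀ ℤ) :
    cayleyBoundary π (translationRep Q X q v) =
      translationRep Q Unit q (cayleyBoundary π v) := by
  induction v using Finsupp.induction_linear with
  | zero => simp
  | add v w hv hw => simp [hv, hw]
  | single p n => obtain ⟨p, x⟩ := p; simp [mul_assoc]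

/-- The fundamental formula of Fox calculus, `∑ₓ (∂f/∂x)(x - 1) = f - 1`. Geometrically, `fox π f`
is the edge path of `f` in the Cayley graph of `Q`, and the boundary records its end points. -/
theorem cayleyBoundary_fox (f : FreeGroup X) :
    cayleyBoundary π (fox π f) = Finsupp.single (π f, ()) 1 - Finsupp.single (1, ()) 1 := by
  induction f using FreeGroup.induction_on with
  | C1 => simp
  | of x => simp
  | inv_of x ih =>
    rw [fox_inv, map_neg, cayleyBoundary_translationRep, ih]
    simp
  | mul f g hf hg =>
    rw [fox_mul, map_add, cayleyBoundary_translationRep, hf, hg]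
    simp

variable {π} (hπ : Function.Surjective π)

/-- The Reidemeister–Schreier generator `σ(q) x σ(q π(x))⁻¹` of `ker π` for the section
`σ = surjInv`. -/
noncomputable def schreierGenerator (q : Q) (f : FreeGroup X) : π.ker :=
  ⟨Function.surjInv hπ q * f * (Function.surjInv hπ (q * π f))⁻¹, by
    rw [MonoidHom.mem_ker, map_mul, map_mul, map_inv, Function.surjInv_eq hπ, Function.surjInv_eq hπ,
      mul_inv_cancel]⟩

theorem schreierGenerator_mul (q : Q) (f g : FreeGroup X) :
    schreierGenerator hπ q (f * g) =
      schreierGenerator hπ q f * schreierGenerator hπ (q * π f) g := by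
  ext1
  simp [schreierGenerator, mul_assoc]

/-- A left inverse, up to conjugation, of the Fox derivative on the relation module. -/
noncomputable def foxSection : (Q × X →₀ ℤ) →ₗ[ℤ] Additive (Abelianization π.ker) :=
  Finsupp.linearCombination ℤ fun p =>
    Additive.ofMul (Abelianization.of (schreierGenerator hπ p.1 (.of p.2)))

@[simp] theorem foxSection_single (q : Q) (x : X) (n : ℤ) :
    foxSection hπ (Finsupp.single (q, x) n) =
      n • Additive.ofMul (Abelianization.of (schreierGenerator hπ q (.of x))) := by
  simp [foxSection]

/-- Both sides read the word `f` along the path starting at `q`, and the Schreier generators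
telescope. The start `q` must vary because the second factor of a product starts where the first one
ends. -/
theorem foxSection_fox (f : FreeGroup X) : ∀ q : Q,
    foxSection hπ (translationRep Q X q (fox π f)) =
      Additive.ofMul (Abelianization.of (schreierGenerator hπ q f)) := by
  have h1 : ∀ q : Q, schreierGenerator hπ q 1 = 1 := fun q => by
    ext1; simp [schreierGenerator]
  induction f using FreeGroup.induction_on with
  | C1 => intro q; simp [h1]
  | of x => intro q; simp
  | inv_of x ih =>
    intro q
    have h2 := schreierGenerator_mul hπ (q * (π (.of x))⁻¹) (.of x) (.of x)⁻¹
    have h3 := schreierGenerator_mul hπ q (.of x)⁻¹ (.of x)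
    rw [inv_mul_cancel, h1] at h3
    have h4 : schreierGenerator hπ q (.of x)⁻¹ = (schreierGenerator hπ (q * π (.of x)⁻¹) (.of x))⁻¹ :=
      eq_inv_of_mul_eq_one_left h3.symm
    rw [fox_inv, map_neg, map_neg, h4, map_inv Abelianization.of, ofMul_inv, ← ih, map_mul]
    rfl
  | mul f g hf hg =>
    intro q
    rw [fox_mul, map_add, map_add, hf, schreierGenerator_mul, map_mul, ofMul_mul, ← hg, map_mul]
    rfl

/-- The `ℤ`-linear map from the relation module `(ker π)ᵃᵇ` to `ℤ[Q × X]` given by the Fox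
derivatives. -/
noncomputable def relationMap (π : FreeGroup X →* Q) :
    Additive (Abelianization π.ker) →ₗ[ℤ] (Q × X →₀ ℤ) :=
  (MonoidHom.toAdditive (Abelianization.lift (G := π.ker) (A := Multiplicative (Q × X →₀ ℤ))
    { toFun := fun n => Multiplicative.ofAdd (fox π n)
      map_one' := by simp
      map_mul' := fun a b => by
        rw [Subgroup.coe_mul, fox_mul, MonoidHom.mem_ker.1 a.2, map_one, ofAdd_add]
        rfl })).toIntLinearMap

@[simp] theorem relationMap_of (n : π.ker) :
    relationMap π (Additive.ofMul (Abelianization.of n)) = fox π n := rfl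

include hπ in
theorem relationMap_injective : Function.Injective (relationMap π) := by
  refine Function.LeftInverse.injective (g := foxSection hπ) fun a => ?_
  obtain ⟨n, rfl⟩ : ∃ n : π.ker, Additive.ofMul (Abelianization.of n) = a :=
    QuotientGroup.mk_surjective a
  have h := foxSection_fox hπ (n : FreeGroup X) 1
  rw [map_one, Module.End.one_apply] at h
  rw [relationMap_of, h]
  -- The section need not send `1` to `1`, so `n` is recovered only up to conjugation by `k ∈ ker
  -- π`, which abelianization ignores.
  let k : π.ker := ⟨Function.surjInv hπ 1, Function.surjInv_eq hπ 1⟩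
  have e : schreierGenerator hπ 1 (n : FreeGroup X) = k * n * k⁻¹ := by
    ext1
    simp [schreierGenerator, k, MonoidHom.mem_ker.1 n.2]
  rw [e, map_mul Abelianization.of, map_mul Abelianization.of, map_inv Abelianization.of,
    mul_right_comm, mul_inv_cancel, one_mul]

include hπ in
theorem relationMap_exact : Function.Exact (relationMap π) (cayleyBoundary π) := by
  intro v
  constructor
  · intro hv
    refine ⟨foxSection hπ v, ?_⟩
    -- A contracting homotopy: `s` sends a vertex `q` to the path `fox (σ q)`. Then `v = relationMap
    -- (foxSection v) + s (∂ v)`, so a cycle lies in the image of the relation module.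
    let s : (Q × Unit →₀ ℤ) →ₗ[ℤ] (Q × X →₀ ℤ) :=
      Finsupp.linearCombination ℤ fun p => fox π (Function.surjInv hπ p.1)
    suffices h : relationMap π (foxSection hπ v) = v - s (cayleyBoundary π v) by
      rw [h, hv, map_zero, sub_zero]
    clear hv
    induction v using Finsupp.induction_linear with
    | zero => simp
    | add v w hv hw =>
      simp only [map_add, hv, hw]
      abel
    | single p n =>
      obtain ⟨q, x⟩ := p
      have h := fox_mul_inv_of_eq π (f := Function.surjInv hπ q * .of x)
        (g := Function.surjInv hπ (q * π (.of x)))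
        (by rw [map_mul, Function.surjInv_eq hπ, Function.surjInv_eq hπ])
      rw [fox_mul π (Function.surjInv hπ q) (.of x), Function.surjInv_eq hπ, fox_of, translationRep_single, mul_one] at h
      rw [foxSection_single, map_smul, relationMap_of, schreierGenerator, h, cayleyBoundary_single]
      simp only [s, map_sub, Finsupp.linearCombination_single]
      rw [smul_sub, smul_add, Finsupp.smul_single, smul_eq_mul, mul_one]
      abel
  · rintro ⟨a, rfl⟩
    obtain ⟨n, rfl⟩ : ∃ n : π.ker, Additive.ofMul (Abelianization.of n) = a :=
      QuotientGroup.mk_surjective a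
    rw [relationMap_of, cayleyBoundary_fox, MonoidHom.mem_ker.1 n.2, sub_self]

include hπ in
-- The image of the boundary is the augmentation ideal, so every `q - 1` annihilates the cokernel:
-- two vertices of the Cayley graph are joined by a path, here the difference of two Fox
-- derivatives.
theorem cayleyBoundary_torsion (q : Q) (v : Q × Unit →₀ ℤ) :
    translationRep Q Unit q v - v ∈ LinearMap.range (cayleyBoundary π) := by
  induction v using Finsupp.induction_linear with
  | zero => simp
  | add v w hv hw =>
    rw [map_add, add_sub_add_comm]
    exact add_mem hv hw
  | single p n =>
    obtain ⟨f, hf⟩ := hπ p.1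
    obtain ⟨g, rfl⟩ := hπ q
    refine ⟨n • (fox π (g * f) - fox π f), ?_⟩
    rw [map_smul, map_sub, cayleyBoundary_fox, cayleyBoundary_fox, sub_sub_sub_cancel_right,
      translationRep_single, smul_sub, Finsupp.smul_single, Finsupp.smul_single]
    simp [hf]

end Fox

end RelationModule

/-! ### Higher-order degrees of a product of a free group with `ℤ` -/

section FreeProdInt

open nonZeroDivisors

variable {G X : Type} [Group G] (e : G ≃* FreeGroup X × Multiplicative ℤ) (n : ℕ)

/-- The projection of `G ≃ F × ℤ` to the free group `F`. -/
def freePart : G →* FreeGroup X := (MonoidHom.fst _ _).comp e.toMonoidHom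

theorem freePart_surjective : Function.Surjective (freePart e) := fun f =>
  ⟨e.symm (f, 1), by simp [freePart]⟩

/-- The image in the free factor `F` of the `n`-th term of the rational derived series. -/
def freePartDerived : Subgroup (FreeGroup X) := (rationalDerivedSeries G (n + 1)).map (freePart e)

instance freePartDerived_normal : (freePartDerived e n).Normal :=
  Subgroup.Normal.map inferInstance _ (freePart_surjective e)

theorem eq_zpow_of_freePart_eq_one {g : G} (h : freePart e g = 1) :
    ∃ k : ℤ, g = e.symm (1, Multiplicative.ofAdd 1) ^ k := by
  refine ⟨(e g).2.toAdd, e.injective ?_⟩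
  rw [map_zpow, MulEquiv.apply_symm_apply]
  refine Prod.ext (by simpa [freePart] using h) ?_
  change (e g).2 = (Multiplicative.ofAdd (1 : ℤ)) ^ (Multiplicative.toAdd (e g).2)
  rw [← ofAdd_zsmul]
  simp

/-- The rational derived series of `G ≃ F × ℤ` lies in the free factor. -/
noncomputable def derivedEquivFreePart : rationalDerivedSeries G (n + 1) ≃*
    (QuotientGroup.mk' (freePartDerived e n)).ker :=
  MulEquiv.ofBijective
    ((freePart e).comp (Subgroup.subtype _) |>.codRestrict _ fun g => by
      rw [QuotientGroup.ker_mk']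
      exact Subgroup.mem_map_of_mem _ g.2) (by
    constructor
    · rw [injective_iff_map_eq_one]
      intro a ha
      have h1 : freePart e a = 1 := congrArg Subtype.val ha
      -- The projection to `ℤ` vanishes on `G_r^(n+1)`, so an element of it is determined by its
      -- free part.
      have h2 : (e a).2 = 1 :=
        MonoidHom.mem_ker.1 (rationalDerivedSeries_succ_le_ker
          ((MonoidHom.snd _ _).comp e.toMonoidHom) n a.2)
      exact Subtype.ext (e.injective (by rw [Subgroup.coe_one, map_one]; exact Prod.ext h1 h2))
    · rintro ⟨f, hf⟩
      rw [QuotientGroup.ker_mk'] at hf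
      obtain ⟨a, ha, rfl⟩ := hf
      exact ⟨⟨a, ha⟩, rfl⟩)

theorem coe_derivedEquivFreePart (a : rationalDerivedSeries G (n + 1)) :
    (derivedEquivFreePart e n a : FreeGroup X) = freePart e a := rfl

variable (ψ : G →* Multiplicative ℤ)

/-- The homomorphism from `ker (Γ_n → ℤ)` to the quotient of the free factor. -/
def kerSubgroupToFreeQuotient : kerSubgroup n ψ →* FreeGroup X ⧸ freePartDerived e n :=
  (QuotientGroup.map _ (freePartDerived e n) (freePart e) (Subgroup.le_comap_map _ _)).comp (Subgroup.subtype _)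

/-- The embedding of the higher-order Alexander module into a free module. -/
noncomputable def alexanderToFree :
    Representation.IntertwiningMap ((alexanderModule G n).comp (kerSubgroup n ψ).subtype)
      ((translationRep (FreeGroup X ⧸ freePartDerived e n) X).comp
        (kerSubgroupToFreeQuotient e n ψ)) :=
  LinearMap.intertwiningMap_of_isIntertwiningMap _ _
    (f := (RelationModule.relationMap (QuotientGroup.mk' (freePartDerived e n))).comp
      (MonoidHom.toAdditive (derivedEquivFreePart e n).abelianizationCongr.toMonoidHom).toIntLinearMap)
    (by
      rintro ⟨g, hg⟩ a
      obtain ⟨g, rfl⟩ := QuotientGroup.mk_surjective g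
      obtain ⟨a, rfl⟩ : ∃ b : rationalDerivedSeries G (n + 1),
        Additive.ofMul (Abelianization.of b) = a := QuotientGroup.mk_surjective a
      have h := RelationModule.fox_conj (QuotientGroup.mk' (freePartDerived e n)) (freePart e g)
        (derivedEquivFreePart e n a)
      refine Eq.trans ?_ h
      refine congrArg (RelationModule.fox _) ?_
      rw [coe_derivedEquivFreePart, ← map_inv, ← map_mul, ← map_mul]
      rfl)

theorem alexanderToFree_injective : Function.Injective (alexanderToFree e n ψ) :=
  (RelationModule.relationMap_injective (QuotientGroup.mk'_surjective _)).comp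
    (derivedEquivFreePart e n).abelianizationCongr.injective

theorem range_alexanderToFree (v) : v ∈ Set.range (alexanderToFree e n ψ) ↔
    v ∈ Set.range (RelationModule.relationMap (QuotientGroup.mk' (freePartDerived e n))) := by
  constructor
  · rintro ⟨a, rfl⟩
    exact ⟨_, rfl⟩
  · rintro ⟨a, rfl⟩
    refine ⟨Additive.ofMul ((derivedEquivFreePart e n).abelianizationCongr.symm a.toMul), ?_⟩
    change RelationModule.relationMap _ (Additive.ofMul
      ((derivedEquivFreePart e n).abelianizationCongr
        ((derivedEquivFreePart e n).abelianizationCongr.symm a.toMul))) = _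
    rw [MulEquiv.apply_symm_apply]
    rfl

/-- The boundary map as an intertwining map of representations of `ker (Γ_n → ℤ)`. -/
noncomputable def freeBoundary :
    Representation.IntertwiningMap
      ((translationRep (FreeGroup X ⧸ freePartDerived e n) X).comp (kerSubgroupToFreeQuotient e n ψ))
      ((translationRep (FreeGroup X ⧸ freePartDerived e n) Unit).comp
        (kerSubgroupToFreeQuotient e n ψ)) :=
  LinearMap.intertwiningMap_of_isIntertwiningMap _ _
    (f := RelationModule.cayleyBoundary (QuotientGroup.mk' (freePartDerived e n)))
    fun _ v => RelationModule.cayleyBoundary_translationRep _ _ v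

variable {e ψ} {m : ℕ} (hc : ψ (e.symm (1, Multiplicative.ofAdd 1)) = Multiplicative.ofAdd (m : ℤ))
  {g : G} (hg : ψ g = Multiplicative.ofAdd 1)

theorem mem_kerSubgroup_mk (y : G) :
    (y : RationalSolvableQuotient G n) ∈ kerSubgroup n ψ ↔ ψ y = 1 := Iff.rfl

include hc hg in
-- Passing to the free part divides out the central element `c`, whose `ψ`-value is `m`. Thus `ψ`
-- survives on `Q` only modulo `m`, and the powers `g ^ j` with `0 ≤ j < m` represent its residue
-- classes.
theorem kerSubgroup_cosets_bijective (hm : m ≠ 0) : Function.Bijective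
    fun p : Fin m × kerSubgroup n ψ => kerSubgroupToFreeQuotient e n ψ p.2 *
      (freePart e (g ^ (p.1 : ℕ)) : FreeGroup X ⧸ freePartDerived e n) := by
  have hfc : freePart e (e.symm (1, Multiplicative.ofAdd 1)) = 1 := by simp [freePart]
  constructor
  · rintro ⟨j, a, ha⟩ ⟨j', a', ha'⟩ h
    obtain ⟨a, rfl⟩ := QuotientGroup.mk_surjective a
    obtain ⟨a', rfl⟩ := QuotientGroup.mk_surjective a'
    have h0 : ((freePart e (a * g ^ (j : ℕ)) : FreeGroup X) : FreeGroup X ⧸ freePartDerived e n) =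
        (freePart e (a' * g ^ (j' : ℕ)) : FreeGroup X) := by
      rw [map_mul, map_mul]; exact h
    obtain ⟨b, hb, hb'⟩ := QuotientGroup.eq.1 h0
    have h1 : freePart e ((a * g ^ (j : ℕ) * b)⁻¹ * (a' * g ^ (j' : ℕ))) = 1 := by
      rw [map_mul, map_inv, map_mul, hb']
      group
    obtain ⟨k, hk⟩ := eq_zpow_of_freePart_eq_one e h1
    have hb1 : ψ b = 1 := rationalDerivedSeries_succ_le_ker ψ n hb
    have ha1 : ψ a = 1 := ha
    have ha1' : ψ a' = 1 := ha'
    have h2 := congrArg (fun y => (ψ y).toAdd) hk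
    simp only [map_mul, map_inv, map_pow, map_zpow, hg, hc, hb1, ha1, ha1'] at h2
    have h3 : -(j : ℤ) + j' = k * m := by simpa using h2
    have hj := j.2
    have hj' := j'.2
    -- Two representatives in the same coset differ by `k * m` in `ψ`, while `|j' - j| < m`.
    have hk0 : k = 0 := by
      by_contra hk0
      have h4 : (m : ℤ) ≤ |k * m| := by
        rw [abs_mul, Nat.abs_cast]
        have : 1 ≤ |k| := Int.one_le_abs hk0
        nlinarith
      rw [← h3] at h4
      have : |-(j : ℤ) + j'| < m := by rw [abs_lt]; omega
      omega
    subst hk0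
    have hjj : j = j' := by ext; omega
    subst hjj
    rw [zpow_zero, inv_mul_eq_one] at hk
    have h5 : (a : RationalSolvableQuotient G n) = a' := by
      rw [QuotientGroup.eq]
      have : a⁻¹ * a' = g ^ (j : ℕ) * b * (g ^ (j : ℕ))⁻¹ := by
        rw [inv_mul_eq_iff_eq_mul, eq_comm, ← mul_assoc, ← mul_assoc, hk]
        group
      rw [this]
      exact (rationalDerivedSeries_normal G (n + 1)).conj_mem b hb _
    simp [h5]
  · intro q
    obtain ⟨f, rfl⟩ := QuotientGroup.mk_surjective q
    obtain ⟨y, rfl⟩ := freePart_surjective e f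
    let i := (ψ y).toAdd
    have hi : ψ y = Multiplicative.ofAdd i := rfl
    have hm' : (m : ℤ) ≠ 0 := by exact_mod_cast hm
    have hlt : (i % m).toNat < m := by
      have := Int.emod_lt_of_pos i (b := m) (by omega)
      omega
    let c := e.symm (1, Multiplicative.ofAdd 1)
    have hcc : ψ c = Multiplicative.ofAdd (m : ℤ) := hc
    -- Division of `ψ y` by `m` with remainder: `g` removes the remainder and `c`, invisible in the
    -- free part, removes the multiple of `m`.
    let y' := y * (g ^ (i % m).toNat)⁻¹ * (c ^ (i / m))⁻¹
    have hy' : ψ y' = 1 := by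
      apply Multiplicative.toAdd.injective
      simp only [y', map_mul, map_inv, map_pow, map_zpow, hg, hcc, hi]
      have : i % m + m * (i / m) = i := Int.emod_add_mul_ediv i m
      have h6 : ((i % m).toNat : ℤ) = i % m := Int.toNat_of_nonneg (Int.emod_nonneg _ hm')
      simp [h6]
      linarith
    refine ⟨⟨⟨_, hlt⟩, ⟨y', hy'⟩⟩, ?_⟩
    change ((freePart e y' : FreeGroup X) : FreeGroup X ⧸ freePartDerived e n) *
      (freePart e (g ^ (i % m).toNat) : FreeGroup X) = _
    have h7 : freePart e y' * freePart e (g ^ (i % m).toNat) = freePart e y := by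
      simp only [y', map_mul, map_inv, map_zpow]
      rw [show freePart e c = 1 from hfc]
      group
    rw [← h7]
    rfl

include hc hg in
-- The element `g ^ m * c⁻¹` has `ψ`-value `0`. Its coordinate in `ℤ` is congruent to `-1` modulo
-- `m`, hence nonzero for `m ≥ 2`, so it survives in `Γ_n`.
theorem exists_kerSubgroup_ne_one (hm : 2 ≤ m) : ∃ h : kerSubgroup n ψ, h ≠ 1 := by
  let c := e.symm (1, Multiplicative.ofAdd 1)
  have hcc : ψ c = Multiplicative.ofAdd (m : ℤ) := hc
  have hy : ψ (g ^ m * c⁻¹) = 1 := by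
    apply Multiplicative.toAdd.injective
    simp [hg, hcc]
  refine ⟨⟨_, (mem_kerSubgroup_mk n _).2 hy⟩, fun h => ?_⟩
  have h1 : g ^ m * c⁻¹ ∈ rationalDerivedSeries G (n + 1) :=
    (QuotientGroup.eq_one_iff _).1 (congrArg Subtype.val h)
  have h2 : (e (g ^ m * c⁻¹)).2 = 1 :=
    MonoidHom.mem_ker.1 (rationalDerivedSeries_succ_le_ker
      ((MonoidHom.snd _ _).comp e.toMonoidHom) n h1)
  have h3 : m * (e g).2.toAdd = 1 := by
    have := congrArg Multiplicative.toAdd h2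
    simp only [c, map_mul, map_inv, map_pow, MulEquiv.apply_symm_apply] at this
    have h4 : m * (e g).2.toAdd + -1 = 0 := by simpa using this
    linarith
  have := Int.isUnit_iff.1 (IsUnit.of_mul_eq_one _ h3)
  omega

include hc hg in
-- An Euler characteristic count on `0 → Nᵃᵇ → ℤ[Q × X] → ℤ[Q]`. The additive form avoids
-- subtraction of cardinals.
theorem higherOrderDegree_of_mulEquiv_freeGroup_prod [Fintype X] (hm : 2 ≤ m) :
    higherOrderDegree n ψ + (m : Cardinal) = ((m * Fintype.card X : ℕ) : Cardinal) := by
  let f := Representation.IntertwiningMap.equivLinearMapAsModule _ _ (alexanderToFree e n ψ)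
  let d := Representation.IntertwiningMap.equivLinearMapAsModule _ _ (freeBoundary e n ψ)
  have hq := kerSubgroup_cosets_bijective n hc hg (by omega : m ≠ 0)
  have hf : Function.Injective f := alexanderToFree_injective e n ψ
  have hfd : Function.Exact f d := fun v =>
    (RelationModule.relationMap_exact (QuotientGroup.mk'_surjective (freePartDerived e n)) v).trans
      (range_alexanderToFree e n ψ v).symm
  have hd : ∀ v, ∃ r : KerGroupRing n ψ, r ≠ 0 ∧ r • v ∈ LinearMap.range d := by
    intro v
    obtain ⟨h, hh⟩ := exists_kerSubgroup_ne_one n hc hg hm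
    -- For `h ≠ 1` the element `h - 1` is a nonzero scalar that maps `ℤ[Q]` into the augmentation
    -- ideal.
    refine ⟨MonoidAlgebra.single h 1 - 1, fun h0 => hh ?_, ?_⟩
    · rw [sub_eq_zero, MonoidAlgebra.one_def] at h0
      exact MonoidAlgebra.single_left_injective one_ne_zero h0
    · obtain ⟨w, hw⟩ := RelationModule.cayleyBoundary_torsion
        (QuotientGroup.mk'_surjective (freePartDerived e n)) (kerSubgroupToFreeQuotient e n ψ h) v
      refine ⟨w, ?_⟩
      rw [sub_smul, one_smul, Representation.single_smul, one_smul]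
      exact hw
  have key := OreLocalization.rank_add_rank_of_exact f d hf hfd hd
  have rank (Y : Type) [Fintype Y] := OreLocalization.rank_of_basis (R := KerGroupRing n ψ)
    (M := Representation.asModule ((translationRep (FreeGroup X ⧸ freePartDerived e n) Y).comp
      (kerSubgroupToFreeQuotient e n ψ))) (translationRepBasis _
        (fun j : Fin m => (freePart e (g ^ (j : ℕ)) : FreeGroup X ⧸ freePartDerived e n)) hq)
  rw [rank X, rank Unit] at key
  simpa [higherOrderDegree] using key

end FreeProdInt

/-! ### Coverings given by a locally constant transition function on two charts -/

section TwoChartCovering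

open Set

universe u v

variable {X : Type u} {F : Type v} [TopologicalSpace X] [Group F] [TopologicalSpace F] [DiscreteTopology F]
  {A B : Set X}

/-- The transition function of `twoChartCore` as a coboundary. -/
def twoChartCochain (g : X → F) (i : Bool) (x : X) : F := if i then 1 else g x

open Classical in
/-- The covering with fibre a discrete group `F` that is trivial over the open sets `A` and `B` and
has the locally constant transition function `g` on `A ∩ B`. -/
noncomputable def twoChartCore (hA : IsOpen A) (hB : IsOpen B) (hAB : A ∪ B = univ) {g : X → F}
    (hg : ContinuousOn g (A ∩ B)) : FiberBundleCore Bool X F where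
  baseSet i := if i then A else B
  isOpen_baseSet := by
    rintro (_ | _)
    exacts [hB, hA]
  indexAt x := decide (x ∈ A)
  mem_baseSet_at x := by
    by_cases hx : x ∈ A
    · simp [hx]
    · simpa [hx] using (hAB.ge (mem_univ x)).resolve_left hx
  coordChange i j x v := twoChartCochain g j x * (twoChartCochain g i x)⁻¹ * v
  coordChange_self i x _ v := by simp
  continuousOn_coordChange i j := by
    have h : ContinuousOn (fun p : X × F => g p.1) ((A ∩ B) ×ˢ univ) :=
      hg.comp continuousOn_fst fun p hp => hp.1
    cases i <;> cases j
    · simpa using continuousOn_snd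
    · have h1 : ContinuousOn (fun p : X × F => (g p.1)⁻¹ * p.2) ((A ∩ B) ×ˢ univ) :=
        h.inv.mul continuousOn_snd
      simpa [twoChartCochain, inter_comm] using h1
    · have h1 : ContinuousOn (fun p : X × F => g p.1 * p.2) ((A ∩ B) ×ˢ univ) :=
        h.mul continuousOn_snd
      simpa [twoChartCochain] using h1
    · simpa using continuousOn_snd
  coordChange_comp i j k x _ v := by group

variable (hA : IsOpen A) (hB : IsOpen B) (hAB : A ∪ B = univ) {g : X → F}
    (hg : ContinuousOn g (A ∩ B))

/-- The point over `x` with coordinate `v` in the chart `i`. -/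
noncomputable def twoChartPoint (i : Bool) (x : X) (v : F) : (twoChartCore hA hB hAB hg).TotalSpace :=
  ⟨x, (twoChartCore hA hB hAB hg).coordChange i ((twoChartCore hA hB hAB hg).indexAt x) x v⟩

theorem twoChartPoint_true (x : X) (v : F) :
    twoChartPoint hA hB hAB hg true x v = twoChartPoint hA hB hAB hg false x (g x * v) := by
  simp [twoChartPoint, twoChartCore, twoChartCochain]

theorem twoChartPoint_injective (i : Bool) (x : X) :
    Function.Injective (twoChartPoint hA hB hAB hg i x) := by
  intro v w h
  have h1 := eq_of_heq (Bundle.TotalSpace.mk.inj h).2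
  exact mul_left_cancel h1

theorem continuous_twoChartPoint {T : Type*} [TopologicalSpace T] (i : Bool) {γ : T → X}
    (hγ : Continuous γ) (h : ∀ t, γ t ∈ (twoChartCore hA hB hAB hg).baseSet i) (v : F) :
    Continuous fun t => twoChartPoint hA hB hAB hg i (γ t) v := by
  let Z := twoChartCore hA hB hAB hg
  have h1 : ContinuousOn (Z.localTriv i).toOpenPartialHomeomorph.symm
      (Z.localTriv i).toOpenPartialHomeomorph.target :=
    (Z.localTriv i).toOpenPartialHomeomorph.continuousOn_symm
  refine h1.comp_continuous (f := fun t => (γ t, v)) (by fun_prop) fun t => ?_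
  exact (Z.mem_localTriv_target i (γ t, v)).2 (h t)

theorem isCoveringMap_twoChartCore : IsCoveringMap (twoChartCore hA hB hAB hg).proj :=
  FiberBundle.isCoveringMap (F := F) (E := (twoChartCore hA hB hAB hg).Fiber)

/-- A path inside one chart lifts with constant coordinate; only a change of chart contributes to
the monodromy. -/
theorem monodromy_twoChartPoint (i : Bool) {x y : X} (γ : Path x y)
    (h : ∀ t, γ t ∈ (twoChartCore hA hB hAB hg).baseSet i) (v : F) :
    (isCoveringMap_twoChartCore hA hB hAB hg).monodromy (Path.Homotopic.Quotient.mk γ)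
      ⟨twoChartPoint hA hB hAB hg i x v, rfl⟩ = ⟨twoChartPoint hA hB hAB hg i y v, rfl⟩ := by
  let Γ : Path (twoChartPoint hA hB hAB hg i x v) (twoChartPoint hA hB hAB hg i y v) :=
    { toFun t := twoChartPoint hA hB hAB hg i (γ t) v
      continuous_toFun := continuous_twoChartPoint hA hB hAB hg i γ.continuous h v
      source' := by rw [γ.source]
      target' := by rw [γ.target] }
  exact (isCoveringMap_twoChartCore hA hB hAB hg).monodromy_map (Path.Homotopic.Quotient.mk Γ)

include hA hB hAB hg in
/-- A locally constant function `g` on the intersection of two open sets covering `X` defines a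
permutation representation of the fundamental group. -/
theorem exists_monodromy_of_locallyConstant {p : X} (hp : g p = 1) :
    ∃ (S : Type (max u v)) (Φ : FundamentalGroup X p →* Equiv.Perm S) (ι : F → S), Function.Injective ι ∧
      ∀ (y : X) (α : Path p y) (β : Path y p), (∀ t, α t ∈ A) → (∀ t, β t ∈ B) → ∀ v,
        Φ (FundamentalGroup.fromPath (Path.Homotopic.Quotient.mk (α.trans β))) (ι v) =
          ι (g y * v) := by
  let cov := isCoveringMap_twoChartCore hA hB hAB hg
  refine ⟨_, cov.monodromyPerm p, fun v => ⟨twoChartPoint hA hB hAB hg true p v, rfl⟩,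
    fun v w h => twoChartPoint_injective hA hB hAB hg true p (congrArg Subtype.val h), ?_⟩
  intro y α β hα hβ v
  rw [cov.coe_monodromyPerm, Path.Homotopic.Quotient.mk_trans, cov.monodromy_trans_apply,
    monodromy_twoChartPoint hA hB hAB hg true α hα]
  -- The charts are switched at `y`, which multiplies the coordinate by `g y`. At `p` they agree
  -- because `g p = 1`.
  simp only [twoChartPoint_true, hp, one_mul]
  exact monodromy_twoChartPoint hA hB hAB hg false β hβ _

end TwoChartCovering

/-! ### The fundamental group of a union of two simply connected open sets -/

section Generation

open Set CategoryTheory Path.Homotopic.Quotient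

variable {X : Type*} [TopologicalSpace X]

theorem IsSimplyConnected.homotopic {A : Set X} (hA : IsSimplyConnected A) {x y : X}
    {γ γ' : Path x y} (h : ∀ t, γ t ∈ A) (h' : ∀ t, γ' t ∈ A) : γ.Homotopic γ' := by
  have := hA.simplyConnectedSpace
  have hx : x ∈ A := by simpa using h 0
  have hy : y ∈ A := by simpa using h 1
  let lift (δ : Path x y) (hδ : ∀ t, δ t ∈ A) : Path (⟨x, hx⟩ : A) ⟨y, hy⟩ :=
    { toFun t := ⟨δ t, hδ t⟩
      source' := by simp
      target' := by simp }
  exact (SimplyConnectedSpace.paths_homotopic (lift γ h) (lift γ' h')).map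
    ⟨Subtype.val, continuous_subtype_val⟩

/-- A subgroup of the fundamental group of `X` is everything if it contains all loops that consist
of two pieces, each lying in a member of an open cover of `X`. -/
theorem mem_of_openCover {ι : Type*} {U : ι → Set X} (hU : ∀ i, IsOpen (U i))
    (hcov : ⋃ i, U i = univ) (hconn : ∀ i, IsPathConnected (U i)) {p : X} (hp : ∀ i, p ∈ U i)
    (H : Subgroup (FundamentalGroup X p))
    (hH : ∀ i j z, ∀ c c' : Path z p, (∀ t, c t ∈ U i) → (∀ t, c' t ∈ U j) →
      FundamentalGroup.fromPath (.mk (c.symm.trans c')) ∈ H) (γ : FundamentalGroup X p) : γ ∈ H := by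
  have hloop : ∀ i (c : Path p p), (∀ t, c t ∈ U i) → FundamentalGroup.fromPath (.mk c) ∈ H := by
    intro i c hc
    have h := hH i i p (Path.refl p) c (fun _ => hp i) hc
    have e : (Path.Homotopic.Quotient.mk ((Path.refl p).symm.trans c)) = .mk c := by
      rw [Path.refl_symm, mk_trans, mk_refl, refl_trans]
    rwa [e] at h
  -- The tail `c` may be exchanged for `c'` at the cost of multiplying by the class of `c⁻¹ c'`.
  -- Multiplication in the fundamental group is concatenation in reverse order.
  have hconv : ∀ i j z (x : Path p z) (c c' : Path z p), (∀ t, c t ∈ U i) → (∀ t, c' t ∈ U j) →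
      FundamentalGroup.fromPath (.mk (x.trans c)) ∈ H →
      FundamentalGroup.fromPath (.mk (x.trans c')) ∈ H := by
    intro i j z x c c' hc hc' h
    have h1 := mul_mem (hH i j z c c' hc hc') h
    rw [FundamentalGroup.mul_def] at h1
    have e : (Path.Homotopic.Quotient.mk (x.trans c)).trans (.mk (c.symm.trans c')) =
        .mk (x.trans c') := by
      simp only [mk_trans, mk_symm]
      rw [trans_assoc, ← trans_assoc (mk c), trans_symm, refl_trans]
    exact e ▸ h1
  obtain ⟨γ, rfl⟩ := Path.Homotopic.Quotient.mk_surjective γ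
  let σ (t : unitInterval) : Path p (γ t) := (γ.subpath 0 t).cast γ.source.symm rfl
  have hσ : ∀ t t', (Path.Homotopic.Quotient.mk (σ t)).trans (.mk (γ.subpath t t')) = .mk (σ t') := by
    intro t t'
    rw [← mk_trans, Path.Homotopic.Quotient.eq]
    exact Path.Homotopic.pathCast ⟨Path.Homotopy.subpathTransSubpath γ 0 t t'⟩ γ.source.symm rfl
  obtain ⟨t, t0, tmono, ⟨N, hN⟩, ht⟩ := exists_monotone_Icc_subset_open_cover_unitInterval
    (fun i => (hU i).preimage γ.continuous) (by rw [← preimage_iUnion, hcov, preimage_univ])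
  -- Induction along a subdivision whose pieces each lie in one member of the cover: an initial
  -- segment of `γ`, closed up by any path within a single member, is a class in `H`.
  have key : ∀ n i (c : Path (γ (t n)) p), (∀ u, c u ∈ U i) →
      FundamentalGroup.fromPath (.mk ((σ (t n)).trans c)) ∈ H := by
    intro n
    induction n with
    | zero =>
      rw [t0]
      intro i c hc
      refine hloop i _ fun u => ?_
      have : (σ 0).trans c u ∈ range (σ 0) ∪ range c := by
        rw [← Path.trans_range]; exact mem_range_self u
      rcases this with ⟨v, hv⟩ | ⟨v, hv⟩
      · rw [← hv]
        simp [σ, hp]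
      · rw [← hv]; exact hc v
    | succ n ih =>
      intro j c hc
      obtain ⟨i, hi⟩ := ht n
      have hend : γ (t (n + 1)) ∈ U i := hi ⟨tmono n.le_succ, le_rfl⟩
      have hjoin := (hconn i).joinedIn _ hend _ (hp i)
      refine hconv i j _ _ hjoin.somePath c hjoin.somePath_mem hc ?_
      have h1 := ih i ((γ.subpath (t n) (t (n + 1))).trans hjoin.somePath) fun u => ?_
      · rwa [mk_trans, mk_trans, ← trans_assoc, hσ, ← mk_trans] at h1
      · have : (γ.subpath (t n) (t (n + 1))).trans hjoin.somePath u ∈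
          range (γ.subpath (t n) (t (n + 1))) ∪ range hjoin.somePath := by
          rw [← Path.trans_range]; exact mem_range_self u
        rcases this with h | ⟨v, hv⟩
        · rw [Path.range_subpath_of_le _ _ _ (tmono n.le_succ)] at h
          obtain ⟨v, hv, hv'⟩ := h
          rw [← hv']
          exact hi hv
        · rw [← hv]; exact hjoin.somePath_mem v
  obtain ⟨i, -⟩ := mem_iUnion.1 (hcov.ge (mem_univ p))
  have h1 := key N i ((Path.refl p).cast (by rw [hN N le_rfl, γ.target]) rfl) fun u => hp i
  have e : ∀ t, t = 1 → ∀ h : γ t = p, (Path.Homotopic.Quotient.mk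
      ((σ t).trans ((Path.refl p).cast h rfl))) = .mk γ := by
    rintro t rfl h
    rw [Path.Homotopic.Quotient.eq]
    have : σ 1 = γ.cast rfl h := by
      ext u
      simp [σ]
    rw [this]
    exact Path.Homotopic.pathCast (p := γ.trans (Path.refl p)) (q := γ)
      ⟨Path.Homotopy.transRefl γ⟩ rfl rfl
  rwa [e _ (hN N le_rfl)] at h1

end Generation

section FreeFundamentalGroup

open Set Path.Homotopic.Quotient

variable {X : Type*} [TopologicalSpace X] {A B : Set X}

/-- If two loops in a simply connected set `A` and in a simply connected set `B` are joined along
the path components of `A ∩ B`, then the resulting classes only depend on the component. -/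
theorem mk_trans_eq_of_isSimplyConnected (hA : IsSimplyConnected A) (hB : IsSimplyConnected B)
    {p q z : X} (δ : Path q z) (hδ : ∀ t, δ t ∈ A ∩ B) {a : Path p z} {b : Path z p}
    {α : Path p q} {β : Path q p} (ha : ∀ t, a t ∈ A) (hb : ∀ t, b t ∈ B) (hα : ∀ t, α t ∈ A)
    (hβ : ∀ t, β t ∈ B) :
    Path.Homotopic.Quotient.mk (a.trans b) = .mk (α.trans β) := by
  have h1 : Path.Homotopic.Quotient.mk a = .mk (α.trans δ) := by
    rw [Path.Homotopic.Quotient.eq]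
    refine hA.homotopic ha fun t => ?_
    have : (α.trans δ) t ∈ range α ∪ range δ := by rw [← Path.trans_range]; exact mem_range_self t
    rcases this with ⟨v, hv⟩ | ⟨v, hv⟩
    · rw [← hv]; exact hα v
    · rw [← hv]; exact (hδ v).1
  have h2 : Path.Homotopic.Quotient.mk b = .mk (δ.symm.trans β) := by
    rw [Path.Homotopic.Quotient.eq]
    refine hB.homotopic hb fun t => ?_
    have : (δ.symm.trans β) t ∈ range δ.symm ∪ range β := by
      rw [← Path.trans_range]; exact mem_range_self t
    rcases this with ⟨v, hv⟩ | ⟨v, hv⟩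
    · rw [← hv]; exact (hδ _).2
    · rw [← hv]; exact hβ v
  rw [mk_trans, h1, h2]
  simp only [mk_trans, mk_symm]
  rw [trans_assoc, ← trans_assoc (mk δ), trans_symm, refl_trans]

/-- The fundamental group of the union of two simply connected open sets whose intersection has
`k + 1` path components is free of rank `k`. -/
theorem nonempty_fundamentalGroup_mulEquiv_freeGroup {k : ℕ} (hAo : IsOpen A) (hBo : IsOpen B)
    (hAB : A ∪ B = univ) (hA : IsSimplyConnected A) (hB : IsSimplyConnected B)
    (s : X → Fin (k + 1)) (hs : ContinuousOn s (A ∩ B))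
    (hW : ∀ j, IsPathConnected {z | z ∈ A ∩ B ∧ s z = j}) (x : X) :
    Nonempty (FundamentalGroup X x ≃* FreeGroup (Fin k)) := by
  choose q hq using fun j => (hW j).nonempty
  let p := q 0
  have hpA : p ∈ A := (hq 0).1.1
  have hpB : p ∈ B := (hq 0).1.2
  choose α hα using fun j => hA.isPathConnected.joinedIn p hpA (q j) (hq j).1.1
  choose β hβ using fun j => hB.isPathConnected.joinedIn (q j) (hq j).1.2 p hpB
  let f : FreeGroup (Fin k) →* FundamentalGroup X p := FreeGroup.lift fun j =>
    FundamentalGroup.fromPath (.mk ((α j.succ).trans (β j.succ)))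
  have hgen : ∀ j, FundamentalGroup.fromPath (.mk ((α j).trans (β j))) ∈ f.range := by
    -- The component `0` contains the base point, so its loop is trivial; this is why `k + 1`
    -- components give only `k` generators.
    refine Fin.cases ?_ fun j => ⟨.of j, by simp [f]⟩
    have e : Path.Homotopic.Quotient.mk ((α 0).trans (β 0)) =
        .mk ((Path.refl p).trans (Path.refl p)) :=
      mk_trans_eq_of_isSimplyConnected hA hB (Path.refl p) (fun _ => ⟨hpA, hpB⟩) (hα 0) (hβ 0)
        (fun _ => hpA) (fun _ => hpB)
    rw [e, mk_trans, mk_refl, refl_trans]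
    exact one_mem _
  have hmix : ∀ z (a : Path p z) (b : Path z p), (∀ t, a t ∈ A) → (∀ t, b t ∈ B) →
      FundamentalGroup.fromPath (.mk (a.trans b)) ∈ f.range := by
    intro z a b ha hb
    have hz : z ∈ A ∩ B := ⟨by simpa using ha 1, by simpa using hb 0⟩
    obtain ⟨δ, hδ⟩ := (hW (s z)).joinedIn _ (hq (s z)) z ⟨hz, rfl⟩
    rw [mk_trans_eq_of_isSimplyConnected hA hB δ (fun t => (hδ t).1) ha hb (hα (s z)) (hβ (s z))]
    exact hgen _
  have hsurj : Function.Surjective f := by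
    rw [← MonoidHom.range_eq_top, Subgroup.eq_top_iff']
    refine mem_of_openCover (U := fun i : Bool => if i then A else B) (Bool.forall_bool.2 ⟨hBo, hAo⟩)
      ?_ (Bool.forall_bool.2 ⟨hB.isPathConnected, hA.isPathConnected⟩)
      (Bool.forall_bool.2 ⟨hpB, hpA⟩) _ ?_
    · exact eq_univ_of_forall fun z => mem_iUnion.2
        ((hAB.ge (mem_univ z)).elim (fun h => ⟨true, h⟩) fun h => ⟨false, h⟩)
    · intro i j z c c' hc hc'
      have hself : ∀ {D : Set X}, IsSimplyConnected D → (∀ t, c t ∈ D) → (∀ t, c' t ∈ D) →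
          FundamentalGroup.fromPath (.mk (c.symm.trans c')) ∈ f.range := by
        intro D hD h h'
        have e : Path.Homotopic.Quotient.mk (c.symm.trans c') = .refl p := by
          rw [mk_trans, mk_symm, Path.Homotopic.Quotient.eq.2 (hD.homotopic h h'), symm_trans]
        rw [e]
        exact one_mem _
      cases i <;> cases j
      · exact hself hB hc hc'
      -- A loop running first through `B` and then through `A` is the inverse of one of the opposite
      -- kind.
      · have h := inv_mem (hmix z c'.symm c (fun t => hc' _) hc)
        rw [FundamentalGroup.inv_def] at h
        have e : (Path.Homotopic.Quotient.mk (c'.symm.trans c)).symm = .mk (c.symm.trans c') := by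
          rw [← mk_symm, Path.trans_symm, Path.symm_symm]
        exact e ▸ h
      · exact hmix z c.symm c' (fun t => hc _) hc'
      · exact hself hA hc hc'
  have hinj : Function.Injective f := by
    let _ : TopologicalSpace (FreeGroup (Fin k)) := ⊥
    have : DiscreteTopology (FreeGroup (Fin k)) := ⟨rfl⟩
    -- The transition function is `1` on the component of the base point and the `j`-th generator on
    -- component `j + 1`. The monodromy of `f w` is then left translation by `w`, which determines
    -- `w`.
    let g : Fin (k + 1) → FreeGroup (Fin k) := Fin.cons 1 FreeGroup.of
    obtain ⟨S, Φ, ι, hι, hΦ⟩ := exists_monodromy_of_locallyConstant (g := g ∘ s) (p := p) hAo hBo hAB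
      (continuous_of_discreteTopology.comp_continuousOn hs) (by simp [g, p, (hq 0).2])
    have key : ∀ w v, Φ (f w) (ι v) = ι (w * v) := by
      intro w
      induction w using FreeGroup.induction_on with
      | C1 => intro v; rw [map_one, map_one, one_mul]; rfl
      | of j =>
        intro v
        have h := hΦ (q j.succ) (α j.succ) (β j.succ) (hα _) (hβ _) v
        rw [Function.comp_apply, (hq j.succ).2] at h
        simpa [f, g] using h
      | inv_of j ih =>
        intro v
        rw [map_inv, map_inv, Equiv.Perm.inv_eq_iff_eq, ih, mul_inv_cancel_left]
      | mul a b ha hb =>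
        intro v
        rw [map_mul, map_mul, Equiv.Perm.mul_apply, hb, ha, mul_assoc]
    intro w w' h
    have h1 := key w 1
    rw [h, key w' 1] at h1
    simpa using (hι h1).symm
  have : PathConnectedSpace X := by
    rw [pathConnectedSpace_iff_univ, ← hAB]
    exact hA.isPathConnected.union hB.isPathConnected ⟨p, hpA, hpB⟩
  exact ⟨(FundamentalGroup.fundamentalGroupMulEquivOfPathConnected x p).trans
    (MulEquiv.ofBijective f ⟨hinj, hsurj⟩).symm⟩

end FreeFundamentalGroup

/-! ### The fundamental group of the plane minus finitely many points -/

section PuncturedPlane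

open Set

/-- The complement in `ℂ` of the vertical rays starting upwards at the points `a i`. -/
def upwardRayCompl {k : ℕ} (a : Fin k → ℂ) : Set ℂ := {w | ∀ i, w.re = (a i).re → w.im < (a i).im}

/-- The complement in `ℂ` of the vertical rays starting downwards at the points `a i`. -/
def downwardRayCompl {k : ℕ} (a : Fin k → ℂ) : Set ℂ := {w | ∀ i, w.re = (a i).re → (a i).im < w.im}

variable {k : ℕ} (a : Fin k → ℂ)

theorem isOpen_upwardRayCompl : IsOpen (upwardRayCompl a) := by
  simp only [upwardRayCompl, ofPred_forall]
  refine isOpen_iInter_of_finite fun i => ?_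
  have : {w : ℂ | w.re = (a i).re → w.im < (a i).im} =
      {w | w.re ≠ (a i).re} ∪ {w | w.im < (a i).im} := by
    ext; simp [imp_iff_not_or]
  rw [this]
  exact (isOpen_ne_fun Complex.continuous_re continuous_const).union
    (isOpen_lt Complex.continuous_im continuous_const)

theorem downwardRayCompl_eq :
    downwardRayCompl a = Complex.conjLIE.toHomeomorph ⁻¹' upwardRayCompl (fun i => star (a i)) := by
  ext w
  simp [upwardRayCompl, downwardRayCompl]

theorem isOpen_downwardRayCompl : IsOpen (downwardRayCompl a) := by
  rw [downwardRayCompl_eq]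
  exact (isOpen_upwardRayCompl _).preimage (Homeomorph.continuous _)

/-- The set is closed under moving downwards. Pushing points vertically into a half plane below all
the `a i` and then contracting this convex half plane is a null-homotopy of the identity. -/
theorem isSimplyConnected_upwardRayCompl : IsSimplyConnected (upwardRayCompl a) := by
  obtain ⟨c, hc⟩ : ∃ c : ℝ, ∀ i, c < (a i).im := by
    obtain ⟨c, hc⟩ := (finite_range fun i => (a i).im).bddBelow
    exact ⟨c - 1, fun i => by linarith [hc (mem_range_self i)]⟩
  have low : ∀ w : ℂ, w.im ≤ c → w ∈ upwardRayCompl a := fun w hw i _ => hw.trans_lt (hc i)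
  have down : ∀ w ∈ upwardRayCompl a, ∀ v : ℂ, v.re = w.re → v.im ≤ w.im → v ∈ upwardRayCompl a :=
    fun w hw v h h' i hi => h'.trans_lt (hw i (h ▸ hi))
  let r : C(upwardRayCompl a, upwardRayCompl a) :=
    { toFun w := ⟨⟨w.1.re, min w.1.im c⟩, low _ (min_le_right _ _)⟩
      continuous_toFun := by
        refine Continuous.subtype_mk ?_ _
        have : Continuous fun w : upwardRayCompl a =>
          ((w.1.re : ℂ) + ((min w.1.im c : ℝ) : ℂ) * Complex.I) := by fun_prop
        convert this using 2 with w
        exact Complex.mk_eq_add_mul_I _ _ }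
  let z : upwardRayCompl a := ⟨⟨0, c⟩, low _ le_rfl⟩
  have h1 : (ContinuousMap.id (upwardRayCompl a)).Homotopic r :=
    ⟨{ toFun p := ⟨(1 - (p.1 : ℝ)) • (p.2 : ℂ) + (p.1 : ℝ) • (r p.2 : ℂ), by
          have h0 := p.1.2.1
          refine down p.2 p.2.2 _ ?_ ?_
          · simp [r]; ring
          · have : min p.2.1.im c ≤ p.2.1.im := min_le_left _ _
            simp [r]
            nlinarith⟩
       continuous_toFun := by fun_prop
       map_zero_left w := by ext; simp
       map_one_left w := by ext; simp }⟩
  have h2 : r.Homotopic (ContinuousMap.const _ z) :=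
    ⟨{ toFun p := ⟨(1 - (p.1 : ℝ)) • (r p.2 : ℂ) + (p.1 : ℝ) • (z : ℂ), by
          have h0 := p.1.2.1
          have h1 := p.1.2.2
          refine low _ ?_
          have : min p.2.1.im c ≤ c := min_le_right _ _
          simp [r, z]
          nlinarith⟩
       continuous_toFun := by fun_prop
       map_zero_left w := by ext; simp
       map_one_left w := by ext; simp }⟩
  have : ContractibleSpace (upwardRayCompl a) :=
    contractible_iff_id_nullhomotopic _ |>.2 ⟨z, h1.trans h2⟩
  exact (inferInstance : SimplyConnectedSpace (upwardRayCompl a))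

theorem isSimplyConnected_downwardRayCompl : IsSimplyConnected (downwardRayCompl a) := by
  rw [downwardRayCompl_eq, Homeomorph.isSimplyConnected_preimage]
  exact isSimplyConnected_upwardRayCompl _

/-- The number of points `a i` to the left of `w`. -/
noncomputable def stripIndex (w : ℂ) : Fin (k + 1) :=
  ⟨(Finset.univ.filter fun i => (a i).re < w.re).card,
    Nat.lt_succ_of_le ((Finset.card_le_univ _).trans (Fintype.card_fin k).le)⟩

theorem mem_inter_rayCompl {w : ℂ} :
    w ∈ upwardRayCompl a ∩ downwardRayCompl a ↔ ∀ i, w.re ≠ (a i).re :=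
  ⟨fun h i hi => lt_asymm (h.1 i hi) (h.2 i hi), fun h =>
    ⟨fun i hi => (h i hi).elim, fun i hi => (h i hi).elim⟩⟩

theorem continuousOn_stripIndex :
    ContinuousOn (stripIndex a) (upwardRayCompl a ∩ downwardRayCompl a) := by
  intro w hw
  rw [mem_inter_rayCompl] at hw
  refine ContinuousAt.continuousWithinAt ?_
  have h : ∀ᶠ v in nhds w, ∀ i, (a i).re < v.re ↔ (a i).re < w.re := by
    rw [Filter.eventually_all]
    intro i
    rcases lt_or_gt_of_ne (hw i) with h | h
    · filter_upwards [(isOpen_lt Complex.continuous_re continuous_const).mem_nhds h] with v hv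
      exact iff_of_false (not_lt_of_gt hv) (not_lt_of_gt h)
    · filter_upwards [(isOpen_lt continuous_const Complex.continuous_re).mem_nhds h] with v hv
      exact iff_of_true hv h
  refine tendsto_const_nhds.congr' ?_
  filter_upwards [h] with v hv
  simp only [stripIndex, hv]

variable {a}

/-- Membership depends only on the real part, and a point lying horizontally between two points of
equal index has the same set of punctures to its left. The piece is thus a convex vertical strip. -/
theorem isPathConnected_strip (ha : StrictMono fun i => (a i).re) (j : Fin (k + 1)) :
    IsPathConnected {w | w ∈ upwardRayCompl a ∩ downwardRayCompl a ∧ stripIndex a w = j} := by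
  refine Convex.isPathConnected ?_ ?_
  · have key : ∀ v w : ℂ, v.re ≤ w.re →
        v ∈ upwardRayCompl a ∩ downwardRayCompl a ∧ stripIndex a v = j →
        w ∈ upwardRayCompl a ∩ downwardRayCompl a ∧ stripIndex a w = j →
        ∀ u : ℂ, v.re ≤ u.re → u.re ≤ w.re →
          u ∈ upwardRayCompl a ∩ downwardRayCompl a ∧ stripIndex a u = j := by
      rintro v w - ⟨hv, hvj⟩ ⟨hw, hwj⟩ u h1 h2
      rw [mem_inter_rayCompl] at *
      have mono : ∀ {x y : ℂ}, x.re ≤ y.re → (Finset.univ.filter fun i => (a i).re < x.re) ⊆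
          Finset.univ.filter fun i => (a i).re < y.re := fun h =>
        Finset.monotone_filter_right _ fun i _ hi => lt_of_lt_of_le hi h
      have e : (Finset.univ.filter fun i => (a i).re < v.re) =
          Finset.univ.filter fun i => (a i).re < w.re :=
        Finset.eq_of_subset_of_card_le (mono (h1.trans h2))
          (congrArg Fin.val (hwj.trans hvj.symm)).le
      have e' : (Finset.univ.filter fun i => (a i).re < u.re) =
          Finset.univ.filter fun i => (a i).re < w.re :=
        (mono h2).antisymm (e ▸ mono h1)
      refine ⟨fun i hi => ?_, ?_⟩
      · have hlt : i ∈ Finset.univ.filter fun i => (a i).re < w.re := by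
          simpa using lt_of_le_of_ne (hi ▸ h2) (hw i).symm
        rw [← e'] at hlt
        have : (a i).re < u.re := by simpa using hlt
        exact this.ne' hi
      · rw [← hwj]
        exact Fin.ext (congrArg Finset.card e')
    intro v hv w hw s t hs ht hst
    have hre : (s • v + t • w).re = s * v.re + t * w.re := by simp
    have hs' : s = 1 - t := by linarith
    rcases le_total v.re w.re with h | h
    · exact key v w h hv hw _ (by rw [hre, hs']; nlinarith) (by rw [hre, hs']; nlinarith)
    · exact key w v h hw hv _ (by rw [hre, hs']; nlinarith) (by rw [hre, hs']; nlinarith)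
  -- A real number separating the first `j` real parts from the others; one of the two sets may be
  -- empty.
  · obtain ⟨y, hy1, hy2⟩ := Order.exists_between_finsets
      (lo := (Finset.univ.filter fun i : Fin k => (i : ℕ) < j).image fun i => (a i).re)
      (hi := (Finset.univ.filter fun i : Fin k => ¬ (i : ℕ) < j).image fun i => (a i).re) (by
        intro x hx y hy
        obtain ⟨i, hi, rfl⟩ := Finset.mem_image.1 hx
        obtain ⟨i', hi', rfl⟩ := Finset.mem_image.1 hy
        refine ha ?_
        rw [Fin.lt_def]
        simp only [Finset.mem_filter, Finset.mem_univ, true_and] at hi hi'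
        omega)
    have h1 : ∀ i : Fin k, (i : ℕ) < j → (a i).re < y := fun i hi =>
      hy1 _ (Finset.mem_image_of_mem _ (by simpa using hi))
    have h2 : ∀ i : Fin k, ¬ (i : ℕ) < j → y < (a i).re := fun i hi =>
      hy2 _ (Finset.mem_image_of_mem _ (by simpa using hi))
    refine ⟨y, (mem_inter_rayCompl a).2 fun i => ?_, ?_⟩
    · by_cases hi : (i : ℕ) < j
      · exact (h1 i hi).ne'
      · exact (h2 i hi).ne
    · have e : (Finset.univ.filter fun i => (a i).re < y) =
          Finset.univ.filter fun i : Fin k => (i : ℕ) < j := by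
        ext i
        simp only [Finset.mem_filter, Finset.mem_univ, true_and]
        exact ⟨fun h => by_contra fun hi => lt_asymm h (h2 i hi), h1 i⟩
      refine Fin.ext ?_
      simp only [stripIndex, Complex.ofReal_re, e]
      rw [Fin.card_filter_val_lt]
      exact min_eq_right (Nat.lt_succ_iff.1 j.2)

/-- A space homeomorphic to the plane minus `k` points with distinct real parts has a free
fundamental group of rank `k`. -/
theorem nonempty_fundamentalGroup_mulEquiv_freeGroup_of_isEmbedding {X : Type*} [TopologicalSpace X]
    {h : X → ℂ} (hh : Topology.IsEmbedding h) (ha : StrictMono fun i => (a i).re)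
    (hr : range h = {w | ∀ i, w ≠ a i}) (x : X) :
    Nonempty (FundamentalGroup X x ≃* FreeGroup (Fin k)) := by
  have hup : h '' (h ⁻¹' upwardRayCompl a) = upwardRayCompl a := by
    rw [image_preimage_eq_iff, hr]
    rintro _ hw i rfl
    exact lt_irrefl _ (hw i rfl)
  have hdown : h '' (h ⁻¹' downwardRayCompl a) = downwardRayCompl a := by
    rw [image_preimage_eq_iff, hr]
    rintro _ hw i rfl
    exact lt_irrefl _ (hw i rfl)
  refine nonempty_fundamentalGroup_mulEquiv_freeGroup
    ((isOpen_upwardRayCompl a).preimage hh.continuous)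
    ((isOpen_downwardRayCompl a).preimage hh.continuous) ?_ ?_ ?_ (stripIndex a ∘ h)
    ((continuousOn_stripIndex a).comp hh.continuous.continuousOn fun y hy => hy) (fun j => ?_) x
  -- A point on both an upward and a downward ray would be a puncture, since distinct punctures lie
  -- on distinct vertical lines.
  · refine eq_univ_of_forall fun y => or_iff_not_imp_left.2 fun hy i hi => ?_
    simp only [mem_preimage, upwardRayCompl, mem_ofPred_eq, not_forall, not_lt] at hy
    obtain ⟨i', hi', hle⟩ := hy
    have : i = i' := ha.injective (hi.symm.trans hi')
    subst this
    refine lt_of_le_of_ne hle fun h' => ?_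
    exact hr.le (mem_range_self y) i (Complex.ext hi h'.symm)
  · rw [← hh.isSimplyConnected_image, hup]
    exact isSimplyConnected_upwardRayCompl a
  · rw [← hh.isSimplyConnected_image, hdown]
    exact isSimplyConnected_downwardRayCompl a
  · rw [hh.isInducing.isPathConnected_iff]
    convert isPathConnected_strip ha j using 1
    ext w
    constructor
    · rintro ⟨y, hy, rfl⟩
      exact hy
    · rintro ⟨hw, hj⟩
      obtain ⟨y, -, rfl⟩ := hup.ge hw.1
      exact ⟨y, ⟨hw, hj⟩, rfl⟩

/-- With `c = 1 + t i`, two points acquire the same real part only if `t` is a certain quotient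
determined by their difference; a real `t` outside these finitely many values works. -/
theorem exists_re_mul_injective {ι : Type*} [Finite ι] {b : ι → ℂ} (hb : Function.Injective b) :
    ∃ c : ℂ, c ≠ 0 ∧ Function.Injective fun i => (c * b i).re := by
  have hfin : (range fun p : ι × ι => (b p.1 - b p.2).re / (b p.1 - b p.2).im).Finite :=
    finite_range _
  obtain ⟨t, ht⟩ := hfin.exists_notMem
  refine ⟨⟨1, t⟩, fun h => by simpa using congrArg Complex.re h, fun i j hij => ?_⟩
  by_contra hne
  have h1 : (b i - b j).re = t * (b i - b j).im := by
    simp at hij ⊢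
    linarith
  by_cases him : (b i - b j).im = 0
  · rw [him, mul_zero] at h1
    exact hne (hb (sub_eq_zero.1 (Complex.ext h1 him)))
  · exact ht ⟨(i, j), by rw [div_eq_iff him]; exact h1⟩

/-- The fundamental group of the plane minus `k` points is free of rank `k`. -/
theorem nonempty_fundamentalGroup_punctured_mulEquiv {b : Fin k → ℂ} (hb : Function.Injective b)
    (x : {w : ℂ // ∀ i, w ≠ b i}) :
    Nonempty (FundamentalGroup {w : ℂ // ∀ i, w ≠ b i} x ≃* FreeGroup (Fin k)) := by
  obtain ⟨c, hc, hinj⟩ := exists_re_mul_injective hb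
  let σ := Tuple.sort fun i => (c * b i).re
  have hmono : StrictMono fun i => (c * b (σ i)).re :=
    (Tuple.monotone_sort fun i => (c * b i).re).strictMono_of_injective (hinj.comp σ.injective)
  refine nonempty_fundamentalGroup_mulEquiv_freeGroup_of_isEmbedding (a := fun i => c * b (σ i))
    ((Homeomorph.mulLeft₀ c hc).isEmbedding.comp Topology.IsEmbedding.subtypeVal) hmono ?_ x
  ext w
  constructor
  · rintro ⟨y, rfl⟩ i h
    exact y.2 (σ i) (mul_left_cancel₀ hc h)
  · intro hw
    refine ⟨⟨c⁻¹ * w, fun i h => hw (σ.symm i) ?_⟩, ?_⟩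
    · rw [Equiv.apply_symm_apply, ← h, mul_inv_cancel_left₀ hc]
    · simp [mul_inv_cancel_left₀ hc]

end PuncturedPlane

/-! ### Fundamental groups of products and winding numbers -/

section ProductDecomposition

variable {U P Q : Type*} [TopologicalSpace U] [TopologicalSpace P] [TopologicalSpace Q]

/-- A homeomorphism `U ≃ P × Q` induces an isomorphism `π₁(U) ≃ π₁(P) × π₁(Q)`. -/
theorem bijective_fundamentalGroup_map_prod (f : C(U, P)) (g : C(U, Q)) (k : C(P × Q, U))
    (hl : ∀ u, k (f u, g u) = u) (hf : ∀ z, f (k z) = z.1) (hg : ∀ z, g (k z) = z.2) (x : U) :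
    Function.Bijective ((FundamentalGroup.map f x).prod (FundamentalGroup.map g x)) := by
  constructor
  · intro γ γ' h
    obtain ⟨γ, rfl⟩ := Path.Homotopic.Quotient.mk_surjective γ
    obtain ⟨γ', rfl⟩ := Path.Homotopic.Quotient.mk_surjective γ'
    have h1 : (γ.map f.continuous).Homotopic (γ'.map f.continuous) :=
      Path.Homotopic.Quotient.exact (congrArg Prod.fst h)
    have h2 : (γ.map g.continuous).Homotopic (γ'.map g.continuous) :=
      Path.Homotopic.Quotient.exact (congrArg Prod.snd h)
    obtain ⟨H1⟩ := h1
    obtain ⟨H2⟩ := h2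
    -- Homotopies in the two factors combine to one in `P × Q`, which `k` carries back to `U`.
    have h3 := (Path.Homotopic.map ⟨Path.Homotopic.prodHomotopy H1 H2⟩ k).pathCast
      (hl x).symm (hl x).symm
    refine Path.Homotopic.Quotient.eq.2 ?_
    convert h3 using 1
    · ext t; simp [hl]
    · ext t; simp [hl]
  · rintro ⟨α, β⟩
    obtain ⟨α, rfl⟩ := Path.Homotopic.Quotient.mk_surjective α
    obtain ⟨β, rfl⟩ := Path.Homotopic.Quotient.mk_surjective β
    refine ⟨.mk (((α.prod β).map k.continuous).cast (hl x).symm (hl x).symm), Prod.ext ?_ ?_⟩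
    · refine congrArg Path.Homotopic.Quotient.mk (Path.ext (funext fun t => ?_))
      simp [hf]
    · refine congrArg Path.Homotopic.Quotient.mk (Path.ext (funext fun t => ?_))
      simp [hg]

end ProductDecomposition

section Winding

/-- The exponential covering has the simply connected total space `ℂ`, so the fundamental group is
its deck group `2πi ℤ`. -/
theorem windingHom_bijective (z : {z : ℂ // z ≠ 0}) : Function.Bijective (windingHom z) := by
  let e : (fun z : ℂ ↦ (⟨_, z.exp_ne_zero⟩ : {z : ℂ // z ≠ 0})) ⁻¹' {z} :=
    ⟨Complex.log z, Subtype.ext (Complex.exp_log z.2)⟩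
  exact (MulOpposite.opMulEquiv.symm.trans zmultiplesTwoPiI.toMultiplicative).bijective.comp
    ⟨Complex.isAddQuotientCoveringMap_exp.fundamentalGroupToMulOpposite_injective e,
      Complex.isAddQuotientCoveringMap_exp.fundamentalGroupToMulOpposite_surjective e⟩

theorem windingHom_of_const (z : {z : ℂ // z ≠ 0}) (γ : Path z z) (h : ∀ t, γ t = z) :
    windingHom z (FundamentalGroup.fromPath (Path.Homotopic.Quotient.mk γ)) = 1 := by
  refine windingHom_mk z γ (ContinuousMap.const _ (Complex.log z)) (fun t => ?_) 0 (by simp)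
  rw [h]
  exact Complex.exp_log z.2

open Complex in
/-- A circle around a disc that contains `0` has winding number `1`. -/
theorem windingHom_of_norm_lt_one (z : {z : ℂ // z ≠ 0}) (γ : Path z z) {K δ : ℂ} (hK : K ≠ 0)
    (hδ : ‖δ‖ < 1) (h : ∀ t, (γ t : ℂ) = K * (exp (2 * Real.pi * I * (t : ℝ)) + δ)) :
    windingHom z (FundamentalGroup.fromPath (Path.Homotopic.Quotient.mk γ)) =
      Multiplicative.ofAdd 1 := by
  have hn : ∀ t : unitInterval, ‖δ * exp (-(2 * Real.pi * I * (t : ℝ)))‖ < 1 := fun t => by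
    rw [norm_mul, show -(2 * Real.pi * I * (t : ℝ)) = ((-(2 * Real.pi * t) : ℝ) : ℂ) * I by
      push_cast; ring, norm_exp_ofReal_mul_I, mul_one]
    exact hδ
  have hs : ∀ t : unitInterval, 1 + δ * exp (-(2 * Real.pi * I * (t : ℝ))) ∈ slitPlane := fun t =>
    mem_slitPlane_of_norm_lt_one (hn t)
  -- After the rotation is factored out, the remaining factor stays in the disc of radius `1` about
  -- `1`, where the principal logarithm is continuous and returns to its initial value.
  let θ : C(unitInterval, ℂ) :=
    { toFun t := log K + 2 * Real.pi * I * (t : ℝ) + log (1 + δ * exp (-(2 * Real.pi * I * (t : ℝ))))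
      continuous_toFun := by
        refine Continuous.add (by fun_prop) (Continuous.clog (by fun_prop) hs) }
  refine windingHom_mk z γ θ (fun t => ?_) 1 ?_
  · simp only [θ, ContinuousMap.coe_mk]
    rw [exp_add, exp_add, exp_log hK, exp_log (slitPlane_ne_zero (hs t)), h t, exp_neg]
    have := exp_ne_zero (2 * Real.pi * I * (t : ℝ))
    field_simp
  · have h1 : exp (-(2 * Real.pi * I)) = 1 := by rw [exp_neg, exp_two_pi_mul_I, inv_one]
    simp [θ, h1]

open Complex in
/-- A circle around a disc whose closure does not contain `0` has winding number `0`. -/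
theorem windingHom_of_one_lt_norm (z : {z : ℂ // z ≠ 0}) (γ : Path z z) {K δ : ℂ} (hK : K ≠ 0)
    (hδ : 1 < ‖δ‖) (h : ∀ t, (γ t : ℂ) = K * (exp (2 * Real.pi * I * (t : ℝ)) + δ)) :
    windingHom z (FundamentalGroup.fromPath (Path.Homotopic.Quotient.mk γ)) = 1 := by
  have hδ0 : δ ≠ 0 := by
    rintro rfl
    rw [norm_zero] at hδ
    linarith
  have hn : ∀ t : unitInterval, ‖exp (2 * Real.pi * I * (t : ℝ)) / δ‖ < 1 := fun t => by
    rw [norm_div, show 2 * Real.pi * I * (t : ℝ) = ((2 * Real.pi * t : ℝ) : ℂ) * I by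
      push_cast; ring, norm_exp_ofReal_mul_I]
    exact (div_lt_one (by linarith)).2 hδ
  have hs : ∀ t : unitInterval, 1 + exp (2 * Real.pi * I * (t : ℝ)) / δ ∈ slitPlane := fun t =>
    mem_slitPlane_of_norm_lt_one (hn t)
  let θ : C(unitInterval, ℂ) :=
    { toFun t := log (K * δ) + log (1 + exp (2 * Real.pi * I * (t : ℝ)) / δ)
      continuous_toFun := by
        refine Continuous.add (by fun_prop) (Continuous.clog (by fun_prop) hs) }
  refine windingHom_mk z γ θ (fun t => ?_) 0 ?_
  · simp only [θ, ContinuousMap.coe_mk]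
    rw [exp_add, exp_log (mul_ne_zero hK hδ0), exp_log (slitPlane_ne_zero (hs t)), h t]
    field_simp
    ring
  · simp [θ, exp_two_pi_mul_I]

/-- For finitely many distinct nonzero points `q i` there is a circle through `0` that encloses
exactly one of them. -/
theorem exists_circle_enclosing_one {ι : Type*} [Finite ι] [Nonempty ι] {q : ι → ℂ}
    (hq : ∀ i, q i ≠ 0) (hinj : Function.Injective q) :
    ∃ c : ℂ, c ≠ 0 ∧ ∃ i, ‖q i / c - 1‖ < 1 ∧ ∀ j, j ≠ i → 1 < ‖q j / c - 1‖ := by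
  -- Take `q i` of least modulus. The closed disc with diameter `[0, q i]` meets the other points
  -- nowhere; moving the center to `s * q i` with `s` slightly above `1 / 2` puts `q i` inside and
  -- keeps the others out.
  obtain ⟨i, hi⟩ := Finite.exists_min fun i => ‖q i‖
  have hev : ∀ j, j ≠ i → ∀ᶠ s : ℝ in nhdsWithin (1 / 2) (Set.Ioi (1 / 2)),
      1 < ‖q j / (s * q i) - 1‖ := by
    intro j hj
    have hlim : Filter.Tendsto (fun s : ℝ => ‖q j / (s * q i) - 1‖)
        (nhdsWithin (1 / 2) (Set.Ioi (1 / 2))) (nhds ‖q j / (((1 / 2 : ℝ) : ℂ) * q i) - 1‖) := by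
      refine (ContinuousAt.tendsto ?_).mono_left nhdsWithin_le_nhds
      have : ((1 / 2 : ℝ) : ℂ) * q i ≠ 0 := mul_ne_zero (by simp) (hq i)
      fun_prop (disch := assumption)
    refine hlim.eventually_const_lt ?_
    set ρ := q j / q i with hρ
    have h1 : q j / (((1 / 2 : ℝ) : ℂ) * q i) - 1 = 2 * ρ - 1 := by
      rw [hρ]
      have := hq i
      push_cast
      field_simp
    have h2 : 1 ≤ ‖ρ‖ := by
      rw [hρ, norm_div, one_le_div (norm_pos_iff.2 (hq i))]
      exact hi j
    have h3 : ρ ≠ 1 := fun h => hj (hinj ((div_eq_one_iff_eq (hq i)).1 h))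
    rw [h1]
    by_contra! h4
    have h5 : ‖2 * ρ - 1‖ ^ 2 ≤ 1 := by nlinarith [norm_nonneg (2 * ρ - 1)]
    -- The first inequality says `|ρ|² ≤ Re ρ`; together with `|ρ| ≥ 1` it forces `ρ = 1`.
    have h6 : 1 ≤ ‖ρ‖ ^ 2 := by nlinarith
    rw [← Complex.normSq_eq_norm_sq, Complex.normSq_apply] at h5 h6
    simp at h5 h6
    refine h3 (Complex.ext ?_ ?_)
    · simp
      nlinarith [sq_nonneg ρ.im, sq_nonneg (ρ.re - 1)]
    · simp
      nlinarith [sq_nonneg ρ.im, sq_nonneg (ρ.re - 1)]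
  have hev' : ∀ᶠ s : ℝ in nhdsWithin (1 / 2) (Set.Ioi (1 / 2)),
      ∀ j, j ≠ i → 1 < ‖q j / (s * q i) - 1‖ := by
    rw [Filter.eventually_all]
    intro j
    by_cases hj : j = i
    · simp [hj]
    · simpa [hj] using hev j hj
  obtain ⟨s, hs, hs1, hs2⟩ := (hev'.and (Ioo_mem_nhdsGT (by norm_num : (1 / 2 : ℝ) < 1))).exists
  have hs0 : (s : ℂ) ≠ 0 := by
    have : s ≠ 0 := by linarith
    exact_mod_cast this
  refine ⟨s * q i, mul_ne_zero hs0 (hq i), i, ?_, hs⟩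
  have h1 : q i / (s * q i) - 1 = ((s⁻¹ - 1 : ℝ) : ℂ) := by
    have := hq i
    push_cast
    field_simp
  rw [h1, Complex.norm_real, Real.norm_eq_abs, abs_lt]
  have h2 : s⁻¹ < 2 := by
    rw [inv_lt_comm₀ (by linarith) (by norm_num)]
    linarith
  have h3 : 0 < s⁻¹ := by
    have : 0 < s := by linarith
    positivity
  constructor <;> linarith

end Winding

/-! ### Central line arrangements -/

section CentralArrangement

/-- A nonzero linear form on `ℂ²` is the first coordinate of a linear coordinate system. -/
theorem exists_linearEquiv_fst_eq {φ : (ℂ × ℂ) →ₗ[ℂ] ℂ} (hφ : φ ≠ 0) :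
    ∃ T : (ℂ × ℂ) ≃ₗ[ℂ] ℂ × ℂ, ∀ z, (T z).1 = φ z := by
  have hz : ∀ z : ℂ × ℂ, φ z = z.1 * φ (1, 0) + z.2 * φ (0, 1) := fun z => by
    rw [← smul_eq_mul, ← smul_eq_mul, ← map_smul, ← map_smul, ← map_add]
    simp
  -- A second form independent of `φ` suffices; one of the two coordinate forms always is.
  suffices h : ∃ V : (ℂ × ℂ) →ₗ[ℂ] ℂ, ∀ z, φ z = 0 → V z = 0 → z = 0 by
    obtain ⟨V, hV⟩ := h
    refine ⟨LinearEquiv.ofInjectiveEndo (φ.prod V) ((injective_iff_map_eq_zero _).2 fun z h => ?_),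
      fun z => rfl⟩
    exact hV z (congrArg Prod.fst h) (congrArg Prod.snd h)
  by_cases hA : φ (1, 0) = 0
  · have hB : φ (0, 1) ≠ 0 := fun hB => hφ (LinearMap.ext fun z => by rw [hz]; simp [hA, hB])
    refine ⟨LinearMap.fst ℂ ℂ ℂ, fun z h1 h2 => ?_⟩
    rw [LinearMap.fst_apply] at h2
    rw [hz, hA, mul_zero, zero_add, mul_eq_zero, or_iff_left hB] at h1
    exact Prod.ext h2 h1
  · refine ⟨LinearMap.snd ℂ ℂ ℂ, fun z h1 h2 => ?_⟩
    rw [LinearMap.snd_apply] at h2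
    rw [hz, h2, zero_mul, add_zero, mul_eq_zero, or_iff_left hA] at h1
    exact Prod.ext h1 h2

/-- Coordinates adapted to distinct lines through a point `p`: the first line is the vertical axis,
the other ones are the graphs of the linear functions with slopes `a i`. -/
theorem exists_adapted_coordinates {k : ℕ} {ℓ : Fin (k + 1) → (ℂ × ℂ) →ᵃ[ℂ] ℂ}
    (hℓ : ∀ i, (ℓ i).linear ≠ 0) (hdist : ∀ i j, i ≠ j → {z | ℓ i z = 0} ≠ {z | ℓ j z = 0})
    {p : ℂ × ℂ} (hp : ∀ i, ℓ i p = 0) :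
    ∃ (T : (ℂ × ℂ) ≃ₗ[ℂ] ℂ × ℂ) (c a : Fin k → ℂ), (∀ i, c i ≠ 0) ∧ Function.Injective a ∧
      (∀ z, ℓ 0 z = (T (z - p)).1) ∧
      ∀ i z, ℓ i.succ z = c i * ((T (z - p)).2 - a i * (T (z - p)).1) := by
  have hlin : ∀ i z, ℓ i z = (ℓ i).linear (z - p) := fun i z => by
    have := (ℓ i).linearMap_vsub z p
    rw [hp i] at this
    simpa using this.symm
  obtain ⟨T, hT⟩ := exists_linearEquiv_fst_eq (hℓ 0)
  have h0 : ∀ z, ℓ 0 z = (T (z - p)).1 := fun z => by rw [hlin, hT]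
  set α : Fin k → ℂ := fun i => (ℓ i.succ).linear (T.symm (1, 0)) with hα
  set c : Fin k → ℂ := fun i => (ℓ i.succ).linear (T.symm (0, 1)) with hc
  have hlin' : ∀ i v, (ℓ i.succ).linear v = (T v).1 * α i + (T v).2 * c i := fun i v => by
    have hv : v = (T v).1 • T.symm (1, 0) + (T v).2 • T.symm (0, 1) := T.injective (by simp)
    conv_lhs => rw [hv, map_add, map_smul, map_smul]
    rfl
  -- If `c i` vanished, `ℓ i.succ` would be a multiple of `ℓ 0` and the two lines would coincide.
  have hc0 : ∀ i, c i ≠ 0 := fun i hi => by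
    have hα0 : α i ≠ 0 := fun h => hℓ i.succ (LinearMap.ext fun v => by rw [hlin']; simp [h, hi])
    refine hdist 0 i.succ (Fin.succ_ne_zero i).symm (Set.ext fun z => ?_)
    rw [Set.mem_ofPred_eq, Set.mem_ofPred_eq, h0, hlin, hlin', hi, mul_zero, add_zero, mul_eq_zero,
      or_iff_left hα0]
  have hs : ∀ i z, ℓ i.succ z = c i * ((T (z - p)).2 - -α i / c i * (T (z - p)).1) := fun i z => by
    rw [hlin, hlin']
    field_simp [hc0 i]
    ring
  refine ⟨T, c, fun i => -α i / c i, hc0, fun i j hij => ?_, h0, hs⟩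
  by_contra hne
  refine hdist i.succ j.succ (fun h => hne (Fin.succ_injective _ h)) (Set.ext fun z => ?_)
  rw [Set.mem_ofPred_eq, Set.mem_ofPred_eq, hs, hs, mul_eq_zero, mul_eq_zero, or_iff_right (hc0 i),
    or_iff_right (hc0 j)]
  simp only at hij
  rw [hij]

/-- At least two lines are needed to cut out a point. -/
theorem two_le_of_iInter_eq_singleton {m : ℕ} {ℓ : Fin m → (ℂ × ℂ) →ᵃ[ℂ] ℂ} {p : ℂ × ℂ}
    (hp : ⋂ i, {z | ℓ i z = 0} = {p}) : 2 ≤ m := by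
  have hmem : ∀ z, (∀ i, ℓ i z = 0) ↔ z = p := fun z => by
    rw [← Set.mem_singleton_iff, ← hp]
    simp
  by_contra! hm
  -- With at most one line there is a direction `v` along which the intersection is translation
  -- invariant, so it is not a point.
  suffices h : ∃ v : ℂ × ℂ, v ≠ 0 ∧ ∀ i, (ℓ i).linear v = 0 by
    obtain ⟨v, hv, h⟩ := h
    refine hv (add_eq_right.1 ((hmem (v + p)).1 fun i => ?_))
    have := (ℓ i).map_vadd p v
    rw [h, (hmem p).2 rfl i] at this
    simpa using this
  interval_cases m
  · exact ⟨(1, 0), by simp, fun i => i.elim0⟩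
  · have : ¬ Function.Injective (ℓ 0).linear := fun h => by
      simpa using LinearMap.finrank_le_finrank_of_injective h
    rw [injective_iff_map_eq_zero] at this
    push Not at this
    obtain ⟨v, h, hv⟩ := this
    exact ⟨v, hv, fun i => by rwa [Subsingleton.elim i 0]⟩

theorem mem_linesComplement_iff {k : ℕ} {ℓ : Fin (k + 1) → (ℂ × ℂ) →ᵃ[ℂ] ℂ} {p : ℂ × ℂ}
    {T : (ℂ × ℂ) ≃ₗ[ℂ] ℂ × ℂ} {c a : Fin k → ℂ} (hc : ∀ i, c i ≠ 0)
    (h0 : ∀ z, ℓ 0 z = (T (z - p)).1)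
    (hs : ∀ i z, ℓ i.succ z = c i * ((T (z - p)).2 - a i * (T (z - p)).1)) (z : ℂ × ℂ) :
    z ∈ linesComplement ℓ ↔
      (T (z - p)).1 ≠ 0 ∧ ∀ i, (T (z - p)).2 - a i * (T (z - p)).1 ≠ 0 := by
  rw [linesComplement, Set.mem_ofPred_eq, Fin.forall_fin_succ, h0]
  simp [hs, hc]

/-- The complement of a central line arrangement is a product of `ℂ ∖ {0}`, the factor being an
equation of the first line, and a plane minus finitely many points. The second projection is
constant on complex lines through the center. -/
theorem exists_linesComplement_prod {k : ℕ} {ℓ : Fin (k + 1) → (ℂ × ℂ) →ᵃ[ℂ] ℂ} {p : ℂ × ℂ}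
    {T : (ℂ × ℂ) ≃ₗ[ℂ] ℂ × ℂ} {c a : Fin k → ℂ} (hc : ∀ i, c i ≠ 0)
    (h0 : ∀ z, ℓ 0 z = (T (z - p)).1)
    (hs : ∀ i z, ℓ i.succ z = c i * ((T (z - p)).2 - a i * (T (z - p)).1)) :
    ∃ (g : C(linesComplement ℓ, {w : ℂ // ∀ i, w ≠ a i}))
      (k : C({z : ℂ // z ≠ 0} × {w : ℂ // ∀ i, w ≠ a i}, linesComplement ℓ)),
      (∀ u, k (lineEquation ℓ 0 u, g u) = u) ∧ (∀ z, lineEquation ℓ 0 (k z) = z.1) ∧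
      (∀ z, g (k z) = z.2) ∧
      ∀ (u v : linesComplement ℓ) (s : ℂ), (v : ℂ × ℂ) = p + s • (u - p) → g v = g u := by
  have hTc : Continuous T := T.toLinearMap.continuous_of_finiteDimensional
  have hTc' : Continuous T.symm := T.symm.toLinearMap.continuous_of_finiteDimensional
  have hmem := mem_linesComplement_iff hc h0 hs
  have hne : ∀ u : linesComplement ℓ, (T ((u : ℂ × ℂ) - p)).1 ≠ 0 := fun u => ((hmem u).1 u.2).1
  let g : C(linesComplement ℓ, {w : ℂ // ∀ i, w ≠ a i}) :=
    { toFun u := ⟨(T (u - p)).2 / (T (u - p)).1, fun i h => ((hmem u).1 u.2).2 i (by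
        rw [← h, div_mul_cancel₀ _ (hne u), sub_self])⟩
      continuous_toFun := by fun_prop (disch := exact hne _) }
  let k : C({z : ℂ // z ≠ 0} × {w : ℂ // ∀ i, w ≠ a i}, linesComplement ℓ) :=
    { toFun z := ⟨p + T.symm (z.1, z.1 * z.2), (hmem _).2 (by
        rw [add_sub_cancel_left, LinearEquiv.apply_symm_apply]
        refine ⟨z.1.2, fun i => ?_⟩
        rw [mul_comm (a i), ← mul_sub]
        exact mul_ne_zero z.1.2 (sub_ne_zero.2 (z.2.2 i)))⟩
      continuous_toFun := by fun_prop }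
  refine ⟨g, k, fun u => Subtype.ext ?_, fun z => Subtype.ext ?_, fun z => Subtype.ext ?_,
    fun u v s huv => Subtype.ext ?_⟩
  · simp only [k, g, lineEquation, ContinuousMap.coe_mk, h0]
    rw [mul_div_cancel₀ _ (hne u), Prod.mk.eta, LinearEquiv.symm_apply_apply, add_sub_cancel]
  · simp [k, lineEquation, h0]
  · simp only [k, g, ContinuousMap.coe_mk, add_sub_cancel_left, LinearEquiv.apply_symm_apply]
    exact mul_div_cancel_left₀ _ z.1.2
  · have h := hne v
    simp only [g, ContinuousMap.coe_mk]
    rw [huv, add_sub_cancel_left, map_smul] at h ⊢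
    exact mul_div_mul_left _ _ (left_ne_zero_of_mul h)

end CentralArrangement

/-! ### The fundamental group of the complement of a central line arrangement -/

section CentralArrangement

theorem affineMap_apply_add_smul_sub {f : (ℂ × ℂ) →ᵃ[ℂ] ℂ} {p : ℂ × ℂ} (hp : f p = 0) (s : ℂ)
    (x : ℂ × ℂ) : f (p + s • (x - p)) = s * f x := by
  have := f.apply_lineMap p x s
  rw [AffineMap.lineMap_apply, AffineMap.lineMap_apply, hp] at this
  simpa [add_comm] using this

open Complex in
/-- The loop obtained by rotating a point of the complement around the center has linking number
`1` with each line. -/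
theorem exists_central_loop {m : ℕ} {ℓ : Fin m → (ℂ × ℂ) →ᵃ[ℂ] ℂ} {p : ℂ × ℂ}
    (hp : ∀ i, ℓ i p = 0) (x : linesComplement ℓ) :
    ∃ γ : Path x x, (∀ t, ∃ s : ℂ, (γ t : ℂ × ℂ) = p + s • (x - p)) ∧
      ∀ i, windingHom (lineEquation ℓ i x) (FundamentalGroup.map (lineEquation ℓ i) x
        (FundamentalGroup.fromPath (Path.Homotopic.Quotient.mk γ))) = Multiplicative.ofAdd 1 := by
  let γ : Path x x :=
    { toFun t := ⟨p + exp (2 * Real.pi * I * (t : ℝ)) • ((x : ℂ × ℂ) - p), fun i => by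
        rw [affineMap_apply_add_smul_sub (hp i)]
        exact mul_ne_zero (exp_ne_zero _) (x.2 i)⟩
      continuous_toFun := by fun_prop
      source' := Subtype.ext (by simp)
      target' := Subtype.ext (by simp [exp_two_pi_mul_I]) }
  refine ⟨γ, fun t => ⟨_, rfl⟩, fun i => ?_⟩
  refine windingHom_of_norm_lt_one (lineEquation ℓ i x) (γ.map (lineEquation ℓ i).continuous)
    (x.2 i) (δ := 0) (by simp) fun t => ?_
  rw [add_zero, mul_comm]
  exact affineMap_apply_add_smul_sub (hp i) _ _

open Complex in
/-- The total linking number homomorphism of a central arrangement is surjective. -/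
theorem exists_totalLinkingHom_eq_one {k : ℕ} [NeZero k] {ℓ : Fin (k + 1) → (ℂ × ℂ) →ᵃ[ℂ] ℂ}
    {p : ℂ × ℂ} {T : (ℂ × ℂ) ≃ₗ[ℂ] ℂ × ℂ} {c a : Fin k → ℂ} (hc : ∀ i, c i ≠ 0)
    (ha : Function.Injective a) (h0 : ∀ z, ℓ 0 z = (T (z - p)).1)
    (hs : ∀ i z, ℓ i.succ z = c i * ((T (z - p)).2 - a i * (T (z - p)).1))
    (x : linesComplement ℓ) : ∃ γ, totalLinkingHom ℓ x γ = Multiplicative.ofAdd 1 := by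
  have hmem := mem_linesComplement_iff hc h0 hs
  obtain ⟨hu, hv⟩ := (hmem x).1 x.2
  set u := (T ((x : ℂ × ℂ) - p)).1 with hu_def
  set v := (T ((x : ℂ × ℂ) - p)).2 with hv_def
  have huv : (x : ℂ × ℂ) = p + T.symm (u, v) := by
    rw [hu_def, hv_def, Prod.mk.eta, LinearEquiv.symm_apply_apply, add_sub_cancel]
  -- In the fibre `u = const` the loop is a circle of radius `|r|` through the base point. Relative
  -- to that point the lines sit at `a j * u - v`, and `δ j` tells whether line `j` is enclosed.
  obtain ⟨r, hr, i, hi, hj⟩ := exists_circle_enclosing_one hv fun i j hij =>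
    ha (mul_right_cancel₀ hu (sub_right_injective hij))
  set δ : Fin k → ℂ := fun i => (v - a i * u) / r - 1 with hδ
  have hδ1 : ∀ j, ‖δ j‖ ≠ 1 := fun j => by
    by_cases hji : j = i
    · rw [hji]
      exact hi.ne
    · exact (hj j hji).ne'
  have hTc' : Continuous T.symm := T.symm.toLinearMap.continuous_of_finiteDimensional
  let w : unitInterval → ℂ × ℂ :=
    fun t => p + T.symm (u, v + r * (exp (2 * Real.pi * I * (t : ℝ)) - 1))
  have hw0 : ∀ t, ℓ 0 (w t) = u := fun t => by simp [w, h0]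
  have hws : ∀ j t, ℓ j.succ (w t) = c j * r * (exp (2 * Real.pi * I * (t : ℝ)) + δ j) :=
    fun j t => by
      simp only [w, hs, hδ, add_sub_cancel_left, LinearEquiv.apply_symm_apply]
      field_simp
      ring
  let γ : Path x x :=
    { toFun t := ⟨w t, fun j => by
        cases j using Fin.cases with
        | zero => rwa [hw0]
        | succ j =>
          rw [hws]
          refine mul_ne_zero (mul_ne_zero (hc j) hr) fun h => hδ1 j ?_
          rw [← norm_neg, ← eq_neg_of_add_eq_zero_left h,
            show 2 * Real.pi * I * (t : ℝ) = ((2 * Real.pi * t : ℝ) : ℂ) * I by push_cast; ring,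
            norm_exp_ofReal_mul_I]⟩
      continuous_toFun := by fun_prop
      source' := Subtype.ext (by simp [w, ← huv])
      target' := Subtype.ext (by simp [w, exp_two_pi_mul_I, ← huv]) }
  refine ⟨FundamentalGroup.fromPath (Path.Homotopic.Quotient.mk γ), ?_⟩
  rw [totalLinkingHom, MonoidHom.finsetProd_apply, Finset.prod_eq_single i.succ]
  · exact windingHom_of_norm_lt_one _ (γ.map (lineEquation ℓ i.succ).continuous)
      (mul_ne_zero (hc i) hr) hi fun t => hws i t
  · intro j _ hne
    cases j using Fin.cases with
    | zero =>
      refine windingHom_of_const _ (γ.map (lineEquation ℓ 0).continuous) fun t => Subtype.ext ?_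
      exact (hw0 t).trans (h0 x).symm
    | succ j =>
      exact windingHom_of_one_lt_norm _ (γ.map (lineEquation ℓ j.succ).continuous)
        (mul_ne_zero (hc j) hr) (hj j fun h => hne (by rw [h])) fun t => hws j t
  · simp

/-- The fundamental group of the complement of a central arrangement of `k + 1` lines is
`F_k × ℤ`, and the total linking number of the generator of the center is `k + 1`. -/
theorem exists_fundamentalGroup_linesComplement_mulEquiv {k : ℕ}
    {ℓ : Fin (k + 1) → (ℂ × ℂ) →ᵃ[ℂ] ℂ} {p : ℂ × ℂ} (hp : ∀ i, ℓ i p = 0)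
    {T : (ℂ × ℂ) ≃ₗ[ℂ] ℂ × ℂ} {c a : Fin k → ℂ} (hc : ∀ i, c i ≠ 0)
    (ha : Function.Injective a) (h0 : ∀ z, ℓ 0 z = (T (z - p)).1)
    (hs : ∀ i z, ℓ i.succ z = c i * ((T (z - p)).2 - a i * (T (z - p)).1))
    (x : linesComplement ℓ) :
    ∃ e : FundamentalGroup (linesComplement ℓ) x ≃* FreeGroup (Fin k) × Multiplicative ℤ,
      totalLinkingHom ℓ x (e.symm (1, Multiplicative.ofAdd 1)) =
        Multiplicative.ofAdd ((k + 1 : ℕ) : ℤ) := by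
  obtain ⟨g, κ, h1, h2, h3, h4⟩ := exists_linesComplement_prod hc h0 hs
  obtain ⟨F⟩ := nonempty_fundamentalGroup_punctured_mulEquiv ha (g x)
  let e : FundamentalGroup (linesComplement ℓ) x ≃* FreeGroup (Fin k) × Multiplicative ℤ :=
    (MulEquiv.ofBijective _ (bijective_fundamentalGroup_map_prod (lineEquation ℓ 0) g κ h1 h2 h3
      x)).trans (MulEquiv.prodComm.trans (MulEquiv.prodCongr F
        (MulEquiv.ofBijective _ (windingHom_bijective (lineEquation ℓ 0 x)))))
  obtain ⟨γ, hγ, hw⟩ := exists_central_loop hp x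
  have he : e (FundamentalGroup.fromPath (Path.Homotopic.Quotient.mk γ)) =
      (1, Multiplicative.ofAdd 1) := by
    refine Prod.ext ?_ (hw 0)
    -- The rotation stays on one complex line through `p`, so its slope coordinate is a constant
    -- path and its free part is trivial.
    have : FundamentalGroup.map g x (FundamentalGroup.fromPath (Path.Homotopic.Quotient.mk γ)) =
        1 := by
      refine congrArg Path.Homotopic.Quotient.mk (a₂ := Path.refl (g x))
        (Path.ext (funext fun t => ?_))
      obtain ⟨s, hst⟩ := hγ t
      exact h4 _ _ s hst
    exact (congrArg F this).trans (map_one F)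
  refine ⟨e, ?_⟩
  rw [← he, MulEquiv.symm_apply_apply, totalLinkingHom, MonoidHom.finsetProd_apply]
  refine (Finset.prod_congr rfl fun i _ => hw i).trans ?_
  rw [Finset.prod_const, Finset.card_univ, Fintype.card_fin, ← ofAdd_nsmul, nsmul_eq_mul, mul_one]

end CentralArrangement
-- The theorem for central line arrangements
theorem mainTheorem7 (m : ℕ) (ℓ : Fin m → (ℂ × ℂ) →ᵃ[ℂ] ℂ) (hℓ : ∀ i, (ℓ i).linear ≠ 0)
    (hdist : ∀ i j, i ≠ j → {z | ℓ i z = 0} ≠ {z | ℓ j z = 0})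
    (p : ℂ × ℂ) (hp : ⋂ i, {z | ℓ i z = 0} = {p}) (x : linesComplement ℓ) :
    Nonempty (FundamentalGroup (linesComplement ℓ) x ≃*
      FreeGroup (Fin (m - 1)) × Multiplicative ℤ) ∧
    ∀ n : ℕ, higherOrderDegree n (totalLinkingHom ℓ x) = ((m * (m - 2) : ℕ) : Cardinal) := by
  have hm := two_le_of_iInter_eq_singleton hp
  have hp0 : ∀ i, ℓ i p = 0 := by simpa using hp.ge (Set.mem_singleton p)
  -- Since `m ≥ 2`, the truncated subtractions in `m - 1` and `m - 2` are genuine.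
  obtain ⟨k, rfl⟩ : ∃ k, m = k + 2 := ⟨m - 2, by omega⟩
  obtain ⟨T, c, a, hc, ha, h0, hs⟩ := exists_adapted_coordinates hℓ hdist hp0
  obtain ⟨e, he⟩ := exists_fundamentalGroup_linesComplement_mulEquiv hp0 hc ha h0 hs x
  obtain ⟨γ, hγ⟩ := exists_totalLinkingHom_eq_one hc ha h0 hs x
  refine ⟨⟨e⟩, fun n => ?_⟩
  have h := higherOrderDegree_of_mulEquiv_freeGroup_prod n he hγ hm
  rw [Fintype.card_fin, show (k + 1 + 1) * (k + 1) = (k + 2) * k + (k + 2) by ring,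
    Nat.cast_add ((k + 2) * k)] at h
  -- Cancelling the summand `m` in cardinal arithmetic is legitimate because it is finite.
  exact Cardinal.eq_of_add_eq_add_right h (Cardinal.natCast_lt_aleph0)
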